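/- Let $x_1,x_2,\dots$ be commuting variables and $\phi_1,\phi_2,\dots,\theta_1,\theta_2,\dots$ pairwise anticommuting variables (in particular $\phi_i^2=\theta_i^2=0$ and $\phi_i\theta_j=-\theta_j\phi_i$). For $N\ge 0$ let $\mathscr P_N$ be the $\mathbb Q$-algebra of polynomials in $x_i,\phi_i,\theta_i$, $1\le i\le N$, graded by the degree $(n|k,l)$ in the $x$'s, the $\phi$'s and the $\theta$'s. A permutation $\sigma\in S_N$ acts on it by $x_i\mapsto x_{\sigma(i)}$, $\phi_i\mapsto\phi_{\sigma(i)}$, $\theta_i\mapsto\theta_{\sigma(i)}$ simultaneously. Let $\mathscr P^{S_\infty}(\mathbb Q)$ be the space of $\mathcal N=2$ symmetric functions in infinitely many variables. It consists of the finite sums of homogeneous elements, a homogeneous element of degree $(n|k,l)$ being a sequence $(f_N)_{N\ge0}$ of $S_N$-invariant elements $f_N\in\mathscr P_N$ of degree $(n|k,l)$ such that setting $x_{N+1}=\phi_{N+1}=\theta_{N+1}=0$ in $f_{N+1}$ gives $f_N$. An $\mathcal N=2$ superpartition is a finite sequence $\Lambda=(\Lambda_1,\dots,\Lambda_\ell)$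 of nonnegative integers, each of which may carry an overline, an underline, both (bilined) or neither (unmarked). The numerical values are weakly decreasing, and parts of equal value are ordered as bilined, overlined, underlined, unmarked. The parts that are only overlined are pairwise distinct, the parts that are only underlined are pairwise distinct, bilined and unmarked parts may be repeated, and unmarked parts equal to $0$ are omitted. Let $\mathrm{SPar}$ be the set of all superpartitions. Put $\overline d f=\sum_i\phi_i\,\partial f/\partial x_i$ and $\underline d f=\sum_i\theta_i\,\partial f/\partial x_i$. For $f=h$ (the complete homogeneous symmetric functions $h_n$ in the $x_i$) and for $f=e$ (the elementary symmetric functions $e_n$ in the $x_i$), attach to a part of numerical value $n$ the factor $f_n$ if it is unmarked, $\overline d f_{n+1}$ if it is overlined, $\underline d f_{n+1}$ if it is underlined, and $\overline d\,\underline d f_{n+2}$ if it is bilined. Let $f_\Lambda$ be the product of the factors of $\Lambda_1,\dots,\Lambda_\ell$, in this order from left to right. Then the homogeneous symmetric functions $h_\Lambda$, $\Lambda\in\mathrm{SPar}$, form a basis of the $\mathbb Q$-vector space $\mathscr P^{S_\infty}(\mathbb Q)$, and the elementary symmetric functions $e_\Lambda$, $\Lambda\in\mathrm{SPar}$, also form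 a basis of $\mathscr P^{S_\infty}(\mathbb Q)$. -/

import Mathlib

open scoped TensorProduct

noncomputable section

namespace SuperSym

/-! ## Superpartitions -/

/-- The four decorations of a part: an overline and an underline, an overline only,
an underline only, or none. -/
inductive Mark : Type
  | bilined
  | overlined
  | underlined
  | unmarked

/-- For parts of equal value: bilined ≻ overlined ≻ underlined ≻ unmarked. -/
def Mark.rank : Mark → ℕ
  | .bilined => 3
  | .overlined => 2
  | .underlined => 1
  | .unmarked => 0

/-- A part of a superpartition: a nonnegative integer with a decoration. -/
structure Part : Type where
  val : ℕ
  mark : Mark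

/-- The strict order `a ≻ b` on parts: first by value, then by decoration. -/
def Part.Gt (a b : Part) : Prop :=
  b.val < a.val ∨ (a.val = b.val ∧ b.mark.rank < a.mark.rank)

/-- A part that may be repeated in a superpartition (bilined or unmarked). -/
def Part.Repeatable (a : Part) : Prop :=
  a.mark = Mark.bilined ∨ a.mark = Mark.unmarked

/-- An `𝒩 = 2` superpartition: a weakly decreasing sequence of parts, in which the parts that
are only overlined are distinct and the parts that are only underlined are distinct.  As for
ordinary partitions, unmarked zeros are disregarded, so a superpartition is represented by its
unique sequence without unmarked zeros; marked zeros are kept. -/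
structure SPar : Type where
  parts : List Part
  decreasing : parts.Pairwise fun a b => a.Gt b ∨ (a = b ∧ a.Repeatable)
  no_unmarked_zero : ∀ a ∈ parts, a.mark = Mark.unmarked → a.val ≠ 0

/-! ## Superpolynomials in `N` variables -/

/-- The Grassmann algebra over `ℚ` on the `2N` anticommuting generators
`φ_1, …, φ_N, θ_1, …, θ_N`. -/
abbrev Grassmann (N : ℕ) : Type := ExteriorAlgebra ℚ (Fin N ⊕ Fin N → ℚ)

/-- The ring of superpolynomials over `ℚ` in the commuting variables `x_i` and the anticommuting
variables `φ_i`, `θ_i`, for `i` in `Fin N`. -/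
abbrev SuperPoly (N : ℕ) : Type := MvPolynomial (Fin N) ℚ ⊗[ℚ] Grassmann N

/-- Ordinary polynomials in `x` as superpolynomials. -/
def ofPoly (N : ℕ) : MvPolynomial (Fin N) ℚ →ₐ[ℚ] SuperPoly N :=
  Algebra.TensorProduct.includeLeft

/-- The anticommuting variable `φ_i`. -/
def phi {N : ℕ} (i : Fin N) : SuperPoly N :=
  1 ⊗ₜ[ℚ] ExteriorAlgebra.ι ℚ (Pi.single (Sum.inl i) 1)

/-- The anticommuting variable `θ_i`. -/
def theta {N : ℕ} (i : Fin N) : SuperPoly N :=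
  1 ⊗ₜ[ℚ] ExteriorAlgebra.ι ℚ (Pi.single (Sum.inr i) 1)

/-- The partial derivative `∂/∂x_i`, with `φ` and `θ` as constants. -/
def dx {N : ℕ} (i : Fin N) : SuperPoly N →ₗ[ℚ] SuperPoly N :=
  TensorProduct.map (MvPolynomial.pderiv i).toLinearMap LinearMap.id

/-- The exterior differentiation `f ↦ ∑ φ_i ∂_i f`. -/
def dOver {N : ℕ} (f : SuperPoly N) : SuperPoly N := ∑ i : Fin N, phi i * dx i f

/-- The exterior differentiation `f ↦ ∑ θ_i ∂_i f`. -/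
def dUnder {N : ℕ} (f : SuperPoly N) : SuperPoly N := ∑ i : Fin N, theta i * dx i f

/-- The diagonal action of a permutation `σ` : `x_i ↦ x_{σ i}`, `φ_i ↦ φ_{σ i}`,
`θ_i ↦ θ_{σ i}`. -/
def permute {N : ℕ} (σ : Equiv.Perm (Fin N)) : SuperPoly N →ₐ[ℚ] SuperPoly N :=
  Algebra.TensorProduct.map (MvPolynomial.rename σ)
    (ExteriorAlgebra.map (LinearMap.funLeft ℚ ℚ (Sum.map σ.symm σ.symm)))

/-- The restriction homomorphism that sets `x_{N+1} = φ_{N+1} = θ_{N+1} = 0`. -/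
def restrict (N : ℕ) : SuperPoly (N + 1) →ₐ[ℚ] SuperPoly N :=
  Algebra.TensorProduct.map
    (MvPolynomial.aeval (Fin.lastCases 0 MvPolynomial.X))
    (ExteriorAlgebra.map (LinearMap.funLeft ℚ ℚ (Sum.map Fin.castSucc Fin.castSucc)))

/-- The superpolynomials that are homogeneous of degree `n` in the `x_i`, degree `k` in the
`φ_i` and degree `l` in the `θ_i`: the span of the monomials of that degree. -/
def homogeneous (N n k l : ℕ) : Submodule ℚ (SuperPoly N) :=
  Submodule.span ℚ
    {f | ∃ (a : Fin N →₀ ℕ) (I : Fin k → Fin N) (J : Fin l → Fin N), a.degree = n ∧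
      f = ofPoly N (MvPolynomial.monomial a 1) * (List.ofFn fun r => phi (I r)).prod *
        (List.ofFn fun r => theta (J r)).prod}

/-! ## Symmetric superfunctions in infinitely many variables -/

/-- The symmetric superfunctions of degree `(n|k,l)` in infinitely many variables: sequences
`(f_N)_N` of symmetric superpolynomials of degree `(n|k,l)` in `N` variables that are compatible
with the restriction homomorphisms. -/
def symSector (n k l : ℕ) : Submodule ℚ (∀ N : ℕ, SuperPoly N) where
  carrier := {f | ∀ N : ℕ, f N ∈ homogeneous N n k l ∧
    (∀ σ : Equiv.Perm (Fin N), permute σ (f N) = f N) ∧ restrict N (f (N + 1)) = f N}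
  zero_mem' := fun N => ⟨Submodule.zero_mem _, fun σ => map_zero _, map_zero _⟩
  add_mem' := fun {f g} hf hg N => by
    refine ⟨Submodule.add_mem _ (hf N).1 (hg N).1, fun σ => ?_, ?_⟩
    · simp only [Pi.add_apply, map_add, (hf N).2.1 σ, (hg N).2.1 σ]
    · simp only [Pi.add_apply, map_add, (hf N).2.2, (hg N).2.2]
  smul_mem' := fun c f hf N => by
    refine ⟨Submodule.smul_mem _ c (hf N).1, fun σ => ?_, ?_⟩
    · simp only [Pi.smul_apply, map_smul, (hf N).2.1 σ]
    · simp only [Pi.smul_apply, map_smul, (hf N).2.2]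

/-- The space of all symmetric superfunctions over `ℚ` in infinitely many variables: finite sums
of symmetric superfunctions of various degrees `(n|k,l)`. -/
def symFun : Submodule ℚ (∀ N : ℕ, SuperPoly N) :=
  ⨆ (n : ℕ) (k : ℕ) (l : ℕ), symSector n k l

/-! ## Multiplicative families -/

/-- The four companions attached to a family `f_n` of symmetric polynomials, in the normalization
used for `h` and `e`: the factor attached to a part of value `n` is `f_n`, `d̄ f_{n+1}`,
`d̲ f_{n+1}` or `d̄ d̲ f_{n+2}`, according to its decoration. -/
def generator (f : ∀ N : ℕ, ℕ → MvPolynomial (Fin N) ℚ) (a : Part) (N : ℕ) : SuperPoly N :=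
  match a.mark with
  | .unmarked => ofPoly N (f N a.val)
  | .overlined => dOver (ofPoly N (f N (a.val + 1)))
  | .underlined => dUnder (ofPoly N (f N (a.val + 1)))
  | .bilined => dOver (dUnder (ofPoly N (f N (a.val + 2))))

/-- The ordered product, from left to right, of the factors attached to the parts of `Λ`. -/
def multiplicative (f : ∀ N : ℕ, ℕ → MvPolynomial (Fin N) ℚ) (Λ : SPar) :
    ∀ N : ℕ, SuperPoly N :=
  (Λ.parts.map (generator f)).prod

/-- The `𝒩 = 2` homogeneous symmetric function `h_Λ`. -/
def hFun (Λ : SPar) : ∀ N : ℕ, SuperPoly N :=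
  multiplicative (fun N n => MvPolynomial.hsymm (Fin N) ℚ n) Λ

/-- The `𝒩 = 2` elementary symmetric function `e_Λ`. -/
def eFun (Λ : SPar) : ∀ N : ℕ, SuperPoly N :=
  multiplicative (fun N n => MvPolynomial.esymm (Fin N) ℚ n) Λ

end SuperSym

end

/-!
The multiplicative families `h_Λ` and `e_Λ` are compared with the products of decorated power sums
`powerFun Λ`, whose factors are `∑ x_i ^ n`, `∑ x_i ^ n φ_i`, `∑ x_i ^ n θ_i` and
`∑ x_i ^ n φ_i θ_i`.

*Coordinates.* To a superpartition `Λ` with `l` parts belongs a monomial in `l` variables, and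
`superCoeff` reads off the coefficient of this monomial in the `l`-variable component of a
superfunction.  These coordinates determine a symmetric superfunction (`eq_zero_of_superCoeff`):
symmetry permutes any monomial into decreasing order, stability removes the variables that do not
occur, and a repeated part that is only overlined or only underlined is killed by the transposition
that exchanges the two anticommuting variables.  Coefficients are defined without a basis of the
exterior algebra, by iterated contraction with coordinate forms (`wordCoeff`).

*Triangularity.* In the expansion of `powerFun M` each factor picks an index.  A term contributes
to the coordinate `Λ` only if the chosen indices exhaust the parts of `Λ`, so that `Λ` has fewer parts
than `M`, or `Λ = M` and equal parts are merely permuted.  The latter terms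
all have coefficient one since the parts that may be repeated have even, hence central, factors.
Thus `powerFun` is triangular (`of_superCoeff_powerFun_ne_zero`, `superCoeff_powerFun_self`).

*Newton's identities.* Both `h_n` and `e_n` are linked to the power sums by a recursion
`p_k = α_k f_k - ∑ β_i f_i p_{k-i}` with `α_k ≠ 0`.  Applying the exterior differentiations to it
and using Leibniz's rule shows by induction that the decorated power sums lie in the span of the
products of generators, graded by total degree (`companion_psum_mem_weightSpan`).  Such products
can be sorted up to sign, so this span is the span of the `f_Λ`.  The same recursion transports
symmetry, stability and homogeneity from the power sums to `f_n`.

*Counting.* There are finitely many superpartitions of each total degree, so within each degree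
the `f_Λ` span all coordinate vectors and are as many as these; hence they form a basis
(`exists_basis_of_triangular`).
-/

noncomputable section

namespace SuperSym

/-! ### Coordinate functionals on the exterior algebra -/

section Exterior

variable {ι κ : Type*}

/-- The functional that extracts the coefficient of `wordProd w`, for a word `w` without
repetitions: contract successively with the coordinate forms named by `w` and take the scalar
part. -/
def wordCoeff : List ι → ExteriorAlgebra ℚ (ι → ℚ) →ₗ[ℚ] ℚ
  | [] => ExteriorAlgebra.algebraMapInv.toLinearMap
  | j :: w => wordCoeff w ∘ₗ
      CliffordAlgebra.contractLeft (Q := (0 : QuadraticForm ℚ (ι → ℚ))) (LinearMap.proj j)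

lemma exists_wordCoeff_perm {w w' : List ι} (h : w.Perm w') :
    ∃ ε : ℚ, ε ≠ 0 ∧ wordCoeff w = ε • wordCoeff w' := by
  induction h with
  | nil => exact ⟨1, one_ne_zero, by simp⟩
  | cons x _ ih =>
    obtain ⟨ε, h0, h⟩ := ih
    exact ⟨ε, h0, by rw [wordCoeff, wordCoeff, h, LinearMap.smul_comp]⟩
  | swap x y l =>
    refine ⟨-1, by norm_num, LinearMap.ext fun z => ?_⟩
    simp only [wordCoeff, LinearMap.comp_apply, LinearMap.smul_apply]
    rw [CliffordAlgebra.contractLeft_comm, map_neg, neg_one_smul]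
  | trans _ _ ih1 ih2 =>
    obtain ⟨ε, h0, h⟩ := ih1
    obtain ⟨δ, h0', h'⟩ := ih2
    exact ⟨ε * δ, mul_ne_zero h0 h0', by rw [h, h', smul_smul]⟩

/-- Multiplication by a generator, as seen by contraction with a coordinate form. -/
lemma contractLeft_ι_mul' (d : Module.Dual ℚ (ι → ℚ)) (v : ι → ℚ)
    (z : ExteriorAlgebra ℚ (ι → ℚ)) :
    CliffordAlgebra.contractLeft (Q := (0 : QuadraticForm ℚ (ι → ℚ))) d
      (ExteriorAlgebra.ι ℚ v * z) = d v • z - ExteriorAlgebra.ι ℚ v *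
        CliffordAlgebra.contractLeft (Q := (0 : QuadraticForm ℚ (ι → ℚ))) d z :=
  CliffordAlgebra.contractLeft_ι_mul _ _ _

lemma contractLeft_map (f : (κ → ℚ) →ₗ[ℚ] (ι → ℚ)) (d : Module.Dual ℚ (ι → ℚ))
    (z : ExteriorAlgebra ℚ (κ → ℚ)) :
    CliffordAlgebra.contractLeft (Q := (0 : QuadraticForm ℚ (ι → ℚ))) d (ExteriorAlgebra.map f z) =
      ExteriorAlgebra.map f
        (CliffordAlgebra.contractLeft (Q := (0 : QuadraticForm ℚ (κ → ℚ))) (d ∘ₗ f) z) := by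
  induction z using CliffordAlgebra.left_induction with
  | algebraMap r =>
    rw [CliffordAlgebra.contractLeft_algebraMap, map_zero]
    erw [AlgHom.commutes, CliffordAlgebra.contractLeft_algebraMap]
  | add a b ha hb => simp only [map_add, ha, hb]
  | ι_mul a v ih =>
    have h : ∀ b, ExteriorAlgebra.map f (CliffordAlgebra.ι 0 v * b) =
        ExteriorAlgebra.ι ℚ (f v) * ExteriorAlgebra.map f b := fun b => by
      rw [← ExteriorAlgebra.map_apply_ι, ← map_mul]
    rw [h, contractLeft_ι_mul', ih, CliffordAlgebra.contractLeft_ι_mul, map_sub, h, map_smul]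
    rfl

lemma wordCoeff_map_funLeft (h : ι → κ) (w : List ι) (z : ExteriorAlgebra ℚ (κ → ℚ)) :
    wordCoeff w (ExteriorAlgebra.map (LinearMap.funLeft ℚ ℚ h) z) = wordCoeff (w.map h) z := by
  induction w generalizing z with
  | nil =>
    simp only [wordCoeff, List.map_nil, AlgHom.toLinearMap_apply]
    rw [← AlgHom.comp_apply]
    congr 1
    ext v
    simp [ExteriorAlgebra.algebraMapInv]
  | cons j w ih =>
    rw [List.map_cons, wordCoeff, wordCoeff, LinearMap.comp_apply, LinearMap.comp_apply,
      contractLeft_map, ih]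
    rfl

variable [DecidableEq ι] [DecidableEq κ]

/-- The product in the exterior algebra of the standard generators named by a word. -/
def wordProd (w : List ι) : ExteriorAlgebra ℚ (ι → ℚ) :=
  (w.map fun j => ExteriorAlgebra.ι ℚ (Pi.single j (1 : ℚ))).prod

@[simp] lemma wordProd_nil : wordProd ([] : List ι) = 1 := rfl

lemma wordProd_cons (j : ι) (w : List ι) :
    wordProd (j :: w) = ExteriorAlgebra.ι ℚ (Pi.single j (1 : ℚ)) * wordProd w := by
  simp [wordProd]

lemma wordProd_append (w w' : List ι) : wordProd (w ++ w') = wordProd w * wordProd w' := by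
  simp [wordProd]

lemma wordProd_swap (i j : ι) (w : List ι) : wordProd (i :: j :: w) = -wordProd (j :: i :: w) := by
  simp only [wordProd_cons, ← mul_assoc]
  rw [eq_neg_of_add_eq_zero_left (ExteriorAlgebra.ι_add_mul_swap (R := ℚ) (M := ι → ℚ)
    (Pi.single i 1) (Pi.single j 1)), neg_mul]

/-- Reordering a word changes its product by a sign, of which only the non-vanishing matters. -/
lemma exists_wordProd_perm {w w' : List ι} (h : w.Perm w') :
    ∃ ε : ℚ, ε ≠ 0 ∧ wordProd w = ε • wordProd w' := by
  induction h with
  | nil => exact ⟨1, one_ne_zero, by simp⟩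
  | cons x _ ih =>
    obtain ⟨ε, h0, h⟩ := ih
    exact ⟨ε, h0, by rw [wordProd_cons, wordProd_cons, h, mul_smul_comm]⟩
  | swap x y l => exact ⟨-1, by norm_num, by rw [wordProd_swap, neg_one_smul]⟩
  | trans _ _ ih1 ih2 =>
    obtain ⟨ε, h0, h⟩ := ih1
    obtain ⟨δ, h0', h'⟩ := ih2
    exact ⟨ε * δ, mul_ne_zero h0 h0', by rw [h, h', smul_smul]⟩

lemma wordProd_eq_zero {w : List ι} (h : ¬ w.Nodup) : wordProd w = 0 := by
  induction w with
  | nil => simp at h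
  | cons j w ih =>
    by_cases hj : j ∈ w
    · obtain ⟨ε, -, h'⟩ := exists_wordProd_perm (List.perm_cons_erase hj)
      rw [wordProd_cons, h', wordProd_cons, mul_smul_comm, ← mul_assoc,
        ExteriorAlgebra.ι_sq_zero, zero_mul, smul_zero]
    · rw [wordProd_cons, ih (by simpa [hj] using h), mul_zero]

lemma contractLeft_wordProd {j : ι} {w : List ι} (h : j ∉ w) :
    CliffordAlgebra.contractLeft (Q := (0 : QuadraticForm ℚ (ι → ℚ))) (LinearMap.proj j)
      (wordProd w) = 0 := by
  induction w with
  | nil => exact CliffordAlgebra.contractLeft_one (Q := (0 : QuadraticForm ℚ (ι → ℚ))) _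
  | cons i w ih =>
    rw [List.mem_cons, not_or] at h
    rw [wordProd_cons, contractLeft_ι_mul', ih h.2, mul_zero, sub_zero, LinearMap.proj_apply,
      Pi.single_eq_of_ne h.1, zero_smul]

lemma contractLeft_wordProd_cons {j : ι} {w : List ι} (h : j ∉ w) :
    CliffordAlgebra.contractLeft (Q := (0 : QuadraticForm ℚ (ι → ℚ))) (LinearMap.proj j)
      (wordProd (j :: w)) = wordProd w := by
  rw [wordProd_cons, contractLeft_ι_mul', contractLeft_wordProd h, mul_zero, sub_zero,
    LinearMap.proj_apply, Pi.single_eq_same, one_smul]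

lemma wordCoeff_self {w : List ι} (h : w.Nodup) : wordCoeff w (wordProd w) = 1 := by
  induction w with
  | nil => simp [wordCoeff]
  | cons j w ih =>
    rw [List.nodup_cons] at h
    rw [wordCoeff, LinearMap.comp_apply, contractLeft_wordProd_cons h.1, ih h.2]

lemma perm_of_wordCoeff_ne_zero {w w' : List ι} (h : wordCoeff w (wordProd w') ≠ 0) :
    w'.Perm w := by
  induction w generalizing w' with
  | nil =>
    cases w' with
    | nil => rfl
    | cons j w' =>
      -- A nonempty product has no scalar part.
      refine absurd ?_ h
      rw [wordProd_cons]
      simp [wordCoeff, ExteriorAlgebra.algebraMapInv]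
  | cons j w ih =>
    rw [wordCoeff, LinearMap.comp_apply] at h
    by_cases hj : j ∈ w'
    · obtain ⟨ε, -, h'⟩ := exists_wordProd_perm (List.perm_cons_erase hj)
      by_cases hj' : j ∈ w'.erase j
      · rw [h', wordProd_eq_zero (by simp [hj'])] at h
        simp at h
      · rw [h', map_smul, contractLeft_wordProd_cons hj', map_smul] at h
        exact (List.perm_cons_erase hj).trans ((ih (right_ne_zero_of_smul h)).cons j)
    · rw [contractLeft_wordProd hj, map_zero] at h
      exact absurd rfl h

lemma span_wordProd [Fintype ι] :
    Submodule.span ℚ (Set.range (wordProd : List ι → ExteriorAlgebra ℚ (ι → ℚ))) = ⊤ := by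
  rw [eq_top_iff]
  rintro z -
  induction z using ExteriorAlgebra.induction with
  | algebraMap r =>
    rw [Algebra.algebraMap_eq_smul_one]
    exact Submodule.smul_mem _ _ (Submodule.subset_span ⟨[], rfl⟩)
  | ι v =>
    rw [← Finset.univ_sum_single v, map_sum]
    refine Submodule.sum_mem _ fun i _ => ?_
    rw [show (Pi.single i (v i) : ι → ℚ) = v i • Pi.single i 1 by
      rw [← Pi.single_smul, smul_eq_mul, mul_one], map_smul]
    exact Submodule.smul_mem _ _ (Submodule.subset_span ⟨[i], by simp [wordProd]⟩)
  | add a b ha hb => exact Submodule.add_mem _ ha hb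
  | mul a b ha hb =>
    have := Submodule.mul_mem_mul ha hb
    rw [Submodule.span_mul_span] at this
    refine Submodule.span_mono ?_ this
    rintro _ ⟨_, ⟨w, rfl⟩, _, ⟨w', rfl⟩, rfl⟩
    exact ⟨w ++ w', wordProd_append w w'⟩

lemma map_funLeft_wordProd [Fintype ι] [Fintype κ] (σ : ι ≃ κ) (w : List ι) :
    ExteriorAlgebra.map (LinearMap.funLeft ℚ ℚ σ.symm) (wordProd w) = wordProd (w.map σ) := by
  induction w with
  | nil => simp
  | cons j w ih =>
    rw [wordProd_cons, map_mul, ih, ExteriorAlgebra.map_apply_ι, List.map_cons, wordProd_cons]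
    congr 3
    ext i
    simp [LinearMap.funLeft_apply, Pi.single_apply, Equiv.symm_apply_eq]

end Exterior

/-! ### Monomials in superpolynomials -/

section Monomials

variable {N : ℕ}

/-- The monomial `x ^ u` times the word `w` in the anticommuting variables; `Sum.inl i` stands
for `φ_i` and `Sum.inr i` for `θ_i`. -/
def mono (u : Fin N →₀ ℕ) (w : List (Fin N ⊕ Fin N)) : SuperPoly N :=
  MvPolynomial.monomial u 1 ⊗ₜ[ℚ] wordProd w

/-- The coefficient of the monomial `mono u w`. -/
def monoCoeff (u : Fin N →₀ ℕ) (w : List (Fin N ⊕ Fin N)) : SuperPoly N →ₗ[ℚ] ℚ :=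
  LinearMap.mul' ℚ ℚ ∘ₗ TensorProduct.map (MvPolynomial.lcoeff ℚ u) (wordCoeff w)

lemma monoCoeff_tmul (u : Fin N →₀ ℕ) (w : List (Fin N ⊕ Fin N)) (p : MvPolynomial (Fin N) ℚ)
    (z : Grassmann N) : monoCoeff u w (p ⊗ₜ z) = p.coeff u * wordCoeff w z := by
  simp [monoCoeff]

lemma mono_mul (u u' : Fin N →₀ ℕ) (w w' : List (Fin N ⊕ Fin N)) :
    mono u w * mono u' w' = mono (u + u') (w ++ w') := by
  simp [mono, MvPolynomial.monomial_mul, wordProd_append]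

@[simp] lemma mono_zero_nil : mono (0 : Fin N →₀ ℕ) [] = 1 := rfl

lemma eq_and_perm_of_monoCoeff_ne_zero {u u' : Fin N →₀ ℕ} {w w' : List (Fin N ⊕ Fin N)}
    (h : monoCoeff u w (mono u' w') ≠ 0) : u' = u ∧ w'.Perm w := by
  rw [mono, monoCoeff_tmul, MvPolynomial.coeff_monomial] at h
  split_ifs at h with h'
  · exact ⟨h', perm_of_wordCoeff_ne_zero (by simpa using h)⟩
  · simp at h

lemma monoCoeff_self (u : Fin N →₀ ℕ) {w : List (Fin N ⊕ Fin N)} (h : w.Nodup) :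
    monoCoeff u w (mono u w) = 1 := by
  rw [mono, monoCoeff_tmul, wordCoeff_self h, MvPolynomial.coeff_monomial, if_pos rfl, one_mul]

lemma exists_monoCoeff_perm (u : Fin N →₀ ℕ) {w w' : List (Fin N ⊕ Fin N)} (h : w.Perm w') :
    ∃ ε : ℚ, ε ≠ 0 ∧ monoCoeff u w = ε • monoCoeff u w' := by
  obtain ⟨ε, h0, h⟩ := exists_wordCoeff_perm h
  exact ⟨ε, h0, by rw [monoCoeff, monoCoeff, h, TensorProduct.map_smul_right, LinearMap.comp_smul]⟩

lemma exists_mono_perm (u : Fin N →₀ ℕ) {w w' : List (Fin N ⊕ Fin N)} (h : w.Perm w') :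
    ∃ ε : ℚ, ε ≠ 0 ∧ mono u w = ε • mono u w' := by
  obtain ⟨ε, h0, h⟩ := exists_wordProd_perm h
  exact ⟨ε, h0, by rw [mono, mono, h, TensorProduct.tmul_smul]⟩

lemma mono_eq_zero (u : Fin N →₀ ℕ) {w : List (Fin N ⊕ Fin N)} (h : ¬ w.Nodup) :
    mono u w = 0 := by
  rw [mono, wordProd_eq_zero h, TensorProduct.tmul_zero]

lemma span_range_mono : Submodule.span ℚ
    (Set.range fun x : (Fin N →₀ ℕ) × List (Fin N ⊕ Fin N) => mono x.1 x.2) = ⊤ := by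
  rw [eq_top_iff, ← TensorProduct.span_tmul_eq_top, Submodule.span_le]
  rintro _ ⟨p, z, rfl⟩
  have hz : z ∈ Submodule.span ℚ (Set.range wordProd) :=
    (span_wordProd (ι := Fin N ⊕ Fin N)) ▸ Submodule.mem_top
  induction p using MvPolynomial.induction_on' with
  | monomial u a =>
    induction hz using Submodule.span_induction with
    | mem x hx =>
      obtain ⟨w, rfl⟩ := hx
      have : MvPolynomial.monomial u a ⊗ₜ[ℚ] wordProd w = a • mono u w := by
        rw [mono, TensorProduct.smul_tmul', MvPolynomial.smul_monomial, smul_eq_mul, mul_one]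
      rw [SetLike.mem_coe, this]
      exact Submodule.smul_mem _ _ (Submodule.subset_span ⟨(u, w), rfl⟩)
    | zero => simp
    | add x y _ _ hx hy =>
      rw [TensorProduct.tmul_add]
      exact Submodule.add_mem _ hx hy
    | smul c x _ hx =>
      rw [TensorProduct.tmul_smul]
      exact Submodule.smul_mem _ _ hx
  | add p q hp hq =>
    rw [TensorProduct.add_tmul]
    exact Submodule.add_mem _ hp hq

/-- Superpolynomials are separated by their coefficients: the monomials `mono u w`, with one
word `w` without repetitions for each finite set of anticommuting variables, span, and the
corresponding coefficient functionals are dual to them. -/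
lemma eq_zero_of_monoCoeff {f : SuperPoly N}
    (h : ∀ u w, w.Nodup → monoCoeff u w f = 0) : f = 0 := by
  let B : (Fin N →₀ ℕ) × Finset (Fin N ⊕ Fin N) → SuperPoly N := fun x => mono x.1 x.2.toList
  have hB : f ∈ Submodule.span ℚ (Set.range B) := by
    suffices h : (⊤ : Submodule ℚ (SuperPoly N)) ≤ Submodule.span ℚ (Set.range B) from
      h Submodule.mem_top
    rw [← span_range_mono, Submodule.span_le]
    rintro _ ⟨⟨u, w⟩, rfl⟩
    dsimp only
    by_cases hw : w.Nodup
    · have hp : w.Perm w.toFinset.toList :=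
        (List.perm_ext_iff_of_nodup hw (Finset.nodup_toList _)).2 (by simp)
      obtain ⟨ε, -, h'⟩ := exists_mono_perm u hp
      rw [h']
      exact Submodule.smul_mem _ _ (Submodule.subset_span ⟨(u, w.toFinset), rfl⟩)
    · rw [mono_eq_zero u hw]
      exact Submodule.zero_mem _
  obtain ⟨c, rfl⟩ := (Finsupp.mem_span_range_iff_exists_finsupp).1 hB
  have hc : c = 0 := by
    ext ⟨u, S⟩
    have := h u S.toList S.nodup_toList
    rw [Finsupp.sum, map_sum, Finset.sum_eq_single (u, S)] at this
    · rwa [map_smul, monoCoeff_self u S.nodup_toList, smul_eq_mul, mul_one] at this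
    · rintro ⟨u', S'⟩ - hne
      by_contra hn
      rw [map_smul] at hn
      obtain ⟨h1, h2⟩ := eq_and_perm_of_monoCoeff_ne_zero (right_ne_zero_of_smul hn)
      refine hne (Prod.ext h1 (Finset.ext fun a => ?_))
      simpa using h2.mem_iff (a := a)
    · intro hn
      rw [Finsupp.notMem_support_iff.1 hn, zero_smul, map_zero]
  simp [hc]

lemma monoCoeff_permute (σ : Equiv.Perm (Fin N)) (u : Fin N →₀ ℕ) (w : List (Fin N ⊕ Fin N))
    (f : SuperPoly N) :
    monoCoeff (u.mapDomain σ) (w.map (Sum.map σ σ)) (permute σ f) = monoCoeff u w f := by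
  induction f using TensorProduct.induction_on with
  | zero => simp
  | add a b ha hb => simp only [map_add, ha, hb]
  | tmul p z =>
    rw [permute, Algebra.TensorProduct.map_tmul, monoCoeff_tmul, monoCoeff_tmul,
      wordCoeff_map_funLeft, MvPolynomial.coeff_rename_mapDomain _ σ.injective, List.map_map,
      Sum.map_comp_map, Equiv.symm_comp_self, Sum.map_id_id, List.map_id]

lemma coeff_aeval_lastCases (u : Fin N →₀ ℕ) (p : MvPolynomial (Fin (N + 1)) ℚ) :
    (MvPolynomial.aeval (Fin.lastCases 0 MvPolynomial.X : Fin (N + 1) → MvPolynomial (Fin N) ℚ)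
      p).coeff u = p.coeff (u.mapDomain Fin.castSucc) := by
  induction p using MvPolynomial.induction_on' with
  | add p q hp hq => rw [map_add, MvPolynomial.coeff_add, MvPolynomial.coeff_add, hp, hq]
  | monomial v a =>
    rw [MvPolynomial.aeval_monomial, Finsupp.prod_fintype _ _ (by simp), Fin.prod_univ_castSucc,
      MvPolynomial.coeff_monomial]
    simp only [Fin.lastCases_castSucc, Fin.lastCases_last]
    have hl : (u.mapDomain Fin.castSucc) (Fin.last N) = 0 :=
      Finsupp.mapDomain_of_notMem_range _ _ (by simp)
    by_cases hv : v (Fin.last N) = 0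
    · have hp : ∏ i : Fin N, (MvPolynomial.X i : MvPolynomial (Fin N) ℚ) ^ v i.castSucc =
          MvPolynomial.monomial (Finsupp.equivFunOnFinite.symm fun i => v i.castSucc) 1 := by
        rw [MvPolynomial.monomial_eq, Finsupp.prod_fintype _ _ (by simp)]
        simp
      rw [hv, pow_zero, mul_one, hp, MvPolynomial.algebraMap_eq, MvPolynomial.coeff_C_mul,
        MvPolynomial.coeff_monomial]
      have : (Finsupp.equivFunOnFinite.symm fun i => v i.castSucc) = u ↔
          v = u.mapDomain Fin.castSucc := by
        simp only [Finsupp.ext_iff]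
        constructor
        · intro h i
          induction i using Fin.lastCases with
          | last => rw [hv, hl]
          | cast i => rw [Finsupp.mapDomain_apply (Fin.castSucc_injective N), ← h i]; rfl
        · intro h i
          rw [← Finsupp.mapDomain_apply (Fin.castSucc_injective N) u i, ← h]; rfl
      simp [this]
    · rw [zero_pow hv, mul_zero, mul_zero, MvPolynomial.coeff_zero, if_neg]
      intro h
      rw [h, hl] at hv
      exact hv rfl

lemma monoCoeff_restrict (u : Fin N →₀ ℕ) (w : List (Fin N ⊕ Fin N)) (f : SuperPoly (N + 1)) :
    monoCoeff u w (restrict N f) =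
      monoCoeff (u.mapDomain Fin.castSucc) (w.map (Sum.map Fin.castSucc Fin.castSucc)) f := by
  induction f using TensorProduct.induction_on with
  | zero => simp
  | add a b ha hb => simp only [map_add, ha, hb]
  | tmul p z =>
    rw [restrict, Algebra.TensorProduct.map_tmul, monoCoeff_tmul, monoCoeff_tmul,
      wordCoeff_map_funLeft, coeff_aeval_lastCases]

end Monomials

/-! ### Monomials attached to decorated exponents -/

section Parts

/-- The word of anticommuting variables with index `i` that a decoration stands for. -/
def Mark.word {α : Type*} (m : Mark) (i : α) : List (α ⊕ α) :=
  match m with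
  | .bilined => [Sum.inl i, Sum.inr i]
  | .overlined => [Sum.inl i]
  | .underlined => [Sum.inr i]
  | .unmarked => []

lemma Mark.inl_mem_word {α : Type*} {m : Mark} {i j : α} :
    Sum.inl i ∈ m.word j ↔ i = j ∧ (m = .bilined ∨ m = .overlined) := by
  cases m <;> simp [Mark.word]

lemma Mark.inr_mem_word {α : Type*} {m : Mark} {i j : α} :
    Sum.inr i ∈ m.word j ↔ i = j ∧ (m = .bilined ∨ m = .underlined) := by
  cases m <;> simp [Mark.word]

lemma Mark.nodup_word {α : Type*} (m : Mark) (i : α) : (m.word i).Nodup := by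
  cases m <;> simp [Mark.word]

variable {N : ℕ}

/-- The exponents of the commuting variables prescribed by a part for each index. -/
def exponent (P : Fin N → Part) : Fin N →₀ ℕ :=
  Finsupp.equivFunOnFinite.symm fun i => (P i).val

/-- The word of anticommuting variables prescribed by a part for each index. -/
def markWord (P : Fin N → Part) : List (Fin N ⊕ Fin N) :=
  (List.finRange N).flatMap fun i => (P i).mark.word i

@[simp] lemma exponent_apply (P : Fin N → Part) (i : Fin N) : exponent P i = (P i).val := rfl

lemma inl_mem_markWord {P : Fin N → Part} {i : Fin N} :
    Sum.inl i ∈ markWord P ↔ (P i).mark = .bilined ∨ (P i).mark = .overlined := by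
  simp [markWord, Mark.inl_mem_word]

lemma inr_mem_markWord {P : Fin N → Part} {i : Fin N} :
    Sum.inr i ∈ markWord P ↔ (P i).mark = .bilined ∨ (P i).mark = .underlined := by
  simp [markWord, Mark.inr_mem_word]

lemma nodup_markWord (P : Fin N → Part) : (markWord P).Nodup := by
  rw [markWord, List.nodup_flatMap]
  refine ⟨fun i _ => Mark.nodup_word _ _, (List.nodup_finRange N).imp fun {i j} hij => ?_⟩
  rintro (k | k) h1 h2
  · exact hij ((Mark.inl_mem_word.1 h1).1.symm.trans (Mark.inl_mem_word.1 h2).1)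
  · exact hij ((Mark.inr_mem_word.1 h1).1.symm.trans (Mark.inr_mem_word.1 h2).1)

/-- The coefficient of the monomial `∏ x_i ^ (P i).val`, decorated by `φ_i` and `θ_i` as
prescribed by the parts `P i`. -/
def partCoeff (P : Fin N → Part) : SuperPoly N →ₗ[ℚ] ℚ :=
  monoCoeff (exponent P) (markWord P)

/-- Every monomial without repeated anticommuting variables is, up to order, the monomial of a
family of parts. -/
lemma exists_parts (u : Fin N →₀ ℕ) {w : List (Fin N ⊕ Fin N)} (hw : w.Nodup) :
    ∃ P : Fin N → Part, exponent P = u ∧ w.Perm (markWord P) := by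
  classical
  refine ⟨fun i => ⟨u i, if Sum.inl i ∈ w then (if Sum.inr i ∈ w then .bilined else .overlined)
    else (if Sum.inr i ∈ w then .underlined else .unmarked)⟩, by ext; simp,
    (List.perm_ext_iff_of_nodup hw (nodup_markWord _)).2 ?_⟩
  rintro (i | i)
  · rw [inl_mem_markWord]
    dsimp only
    split_ifs <;> simp_all
  · rw [inr_mem_markWord]
    dsimp only
    split_ifs <;> simp_all

lemma markWord_comp_perm (P : Fin N → Part) (σ : Equiv.Perm (Fin N)) :
    ((markWord (P ∘ σ)).map (Sum.map σ σ)).Perm (markWord P) := by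
  refine (List.perm_ext_iff_of_nodup ((nodup_markWord _).map
    (Sum.map_injective.2 ⟨σ.injective, σ.injective⟩)) (nodup_markWord _)).2 ?_
  rintro (i | i)
  · obtain ⟨j, rfl⟩ := σ.surjective i
    rw [show (Sum.inl (σ j) : Fin N ⊕ Fin N) = Sum.map σ σ (Sum.inl j) from rfl,
      List.mem_map_of_injective (Sum.map_injective.2 ⟨σ.injective, σ.injective⟩), Sum.map_inl,
      inl_mem_markWord, inl_mem_markWord, Function.comp_apply]
  · obtain ⟨j, rfl⟩ := σ.surjective i
    rw [show (Sum.inr (σ j) : Fin N ⊕ Fin N) = Sum.map σ σ (Sum.inr j) from rfl,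
      List.mem_map_of_injective (Sum.map_injective.2 ⟨σ.injective, σ.injective⟩), Sum.map_inr,
      inr_mem_markWord, inr_mem_markWord, Function.comp_apply]

lemma exponent_comp_perm (P : Fin N → Part) (σ : Equiv.Perm (Fin N)) :
    (exponent (P ∘ σ)).mapDomain σ = exponent P := by
  ext i
  rw [Finsupp.mapDomain_equiv_apply]
  simp

/-- Symmetry of `f` lets one reorder the parts. -/
lemma exists_partCoeff_comp_perm {f : SuperPoly N} (hf : ∀ σ, permute σ f = f)
    (P : Fin N → Part) (σ : Equiv.Perm (Fin N)) :
    ∃ ε : ℚ, ε ≠ 0 ∧ partCoeff (P ∘ σ) f = ε * partCoeff P f := by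
  obtain ⟨ε, h0, h⟩ := exists_monoCoeff_perm (exponent P) (markWord_comp_perm P σ)
  refine ⟨ε, h0, ?_⟩
  rw [partCoeff, ← monoCoeff_permute σ, hf, exponent_comp_perm, h]
  rfl

/-- Stability lets one drop a trailing trivial part. -/
lemma exists_partCoeff_restrict (f : SuperPoly (N + 1)) (P : Fin (N + 1) → Part)
    (h0 : (P (Fin.last N)).val = 0) (hm : (P (Fin.last N)).mark = .unmarked) :
    ∃ ε : ℚ, ε ≠ 0 ∧ partCoeff (P ∘ Fin.castSucc) (restrict N f) = ε * partCoeff P f := by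
  have hi : Function.Injective (Sum.map (Fin.castSucc (n := N)) (Fin.castSucc (n := N))) :=
    Sum.map_injective.2 ⟨Fin.castSucc_injective N, Fin.castSucc_injective N⟩
  have hw : ((markWord (P ∘ Fin.castSucc)).map (Sum.map Fin.castSucc Fin.castSucc)).Perm
      (markWord P) := by
    refine (List.perm_ext_iff_of_nodup ((nodup_markWord _).map hi) (nodup_markWord _)).2 ?_
    rintro (i | i)
    · induction i using Fin.lastCases with
      | last => simp [inl_mem_markWord, hm, Fin.castSucc_ne_last]
      | cast i =>
        rw [show (Sum.inl i.castSucc : Fin (N + 1) ⊕ Fin (N + 1)) =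
          Sum.map Fin.castSucc Fin.castSucc (Sum.inl i) from rfl,
          List.mem_map_of_injective hi, Sum.map_inl, inl_mem_markWord, inl_mem_markWord,
          Function.comp_apply]
    · induction i using Fin.lastCases with
      | last => simp [inr_mem_markWord, hm, Fin.castSucc_ne_last]
      | cast i =>
        rw [show (Sum.inr i.castSucc : Fin (N + 1) ⊕ Fin (N + 1)) =
          Sum.map Fin.castSucc Fin.castSucc (Sum.inr i) from rfl,
          List.mem_map_of_injective hi, Sum.map_inr, inr_mem_markWord, inr_mem_markWord,
          Function.comp_apply]
  have hu : (exponent (P ∘ Fin.castSucc)).mapDomain Fin.castSucc = exponent P := by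
    ext i
    induction i using Fin.lastCases with
    | last =>
      rw [Finsupp.mapDomain_of_notMem_range _ _ (by simp), exponent_apply, h0]
    | cast i => rw [Finsupp.mapDomain_apply (Fin.castSucc_injective N)]; rfl
  obtain ⟨ε, hε, h⟩ := exists_monoCoeff_perm (exponent P) hw
  refine ⟨ε, hε, ?_⟩
  rw [partCoeff, monoCoeff_restrict, hu, h]
  rfl

/-- A transposition that exchanges two letters of a word and fixes the others and the exponents
changes the sign of the coefficient, so that the coefficient in a symmetric superpolynomial
vanishes. -/
lemma partCoeff_eq_zero_of_swap {f : SuperPoly N} (hf : ∀ σ, permute σ f = f) (P : Fin N → Part)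
    (σ : Equiv.Perm (Fin N)) (hσ : P ∘ σ = P) {a b : Fin N ⊕ Fin N} (hab : a ≠ b)
    (ha : a ∈ markWord P) (hb : b ∈ markWord P) (hab' : Sum.map σ σ a = b)
    (hba : Sum.map σ σ b = a)
    (hc : ∀ c ∈ markWord P, c ≠ a → c ≠ b → Sum.map σ σ c = c) : partCoeff P f = 0 := by
  set r := (markWord P).filter fun c => c ≠ a ∧ c ≠ b with hr
  have hp : (markWord P).Perm (a :: b :: r) := by
    refine (List.perm_ext_iff_of_nodup (nodup_markWord P) ?_).2 fun c => ?_
    · simp [hr, hab, (nodup_markWord P).filter]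
    · by_cases h1 : c = a <;> by_cases h2 : c = b <;> simp_all
  have hr' : r.map (Sum.map σ σ) = r := by
    conv_rhs => rw [← List.map_id r]
    refine List.map_congr_left fun c hcr => ?_
    simp only [hr, List.mem_filter, decide_eq_true_eq] at hcr
    exact hc c hcr.1 hcr.2.1 hcr.2.2
  obtain ⟨ε, -, h⟩ := exists_monoCoeff_perm (exponent P) hp
  have key : monoCoeff (exponent P) (a :: b :: r) f = -monoCoeff (exponent P) (a :: b :: r) f := by
    conv_lhs => rw [← monoCoeff_permute σ, hf]
    rw [List.map_cons, List.map_cons, hr', hab', hba]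
    conv_lhs => rw [← hσ, exponent_comp_perm]
    have : monoCoeff (exponent P) (b :: a :: r) = -monoCoeff (exponent P) (a :: b :: r) := by
      refine TensorProduct.ext' fun p z => ?_
      rw [LinearMap.neg_apply, monoCoeff_tmul, monoCoeff_tmul]
      simp only [wordCoeff, LinearMap.comp_apply]
      rw [CliffordAlgebra.contractLeft_comm, map_neg, mul_neg]
    rw [this, LinearMap.neg_apply]
  rw [partCoeff, h, LinearMap.smul_apply, self_eq_neg.1 key, smul_zero]

lemma partCoeff_eq_zero_of_eq {f : SuperPoly N} (hf : ∀ σ, permute σ f = f) {P : Fin N → Part}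
    {i j : Fin N} (hij : i ≠ j) (hP : P i = P j) (hn : ¬ (P i).Repeatable) :
    partCoeff P f = 0 := by
  have hσ : P ∘ Equiv.swap i j = P := by
    ext1 k
    rw [Function.comp_apply, Equiv.swap_apply_def]
    split_ifs with h1 h2
    · rw [h1, hP]
    · rw [h2, hP]
    · rfl
  have hj : ¬ (P j).Repeatable := hP ▸ hn
  cases hm : (P i).mark with
  | bilined => exact absurd (Or.inl hm) hn
  | unmarked => exact absurd (Or.inr hm) hn
  | overlined =>
    have hm' : (P j).mark = .overlined := hP ▸ hm
    refine partCoeff_eq_zero_of_swap hf P (Equiv.swap i j) hσ (a := Sum.inl i) (b := Sum.inl j)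
      (by simpa using hij) (inl_mem_markWord.2 (.inr hm)) (inl_mem_markWord.2 (.inr hm'))
      (by simp) (by simp) ?_
    rintro (c | c) hc h1 h2
    · rw [Sum.map_inl, Equiv.swap_apply_of_ne_of_ne (by simpa using h1) (by simpa using h2)]
    · rw [inr_mem_markWord] at hc
      rw [Sum.map_inr, Equiv.swap_apply_of_ne_of_ne] <;> rintro rfl <;> simp_all
  | underlined =>
    have hm' : (P j).mark = .underlined := hP ▸ hm
    refine partCoeff_eq_zero_of_swap hf P (Equiv.swap i j) hσ (a := Sum.inr i) (b := Sum.inr j)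
      (by simpa using hij) (inr_mem_markWord.2 (.inr hm)) (inr_mem_markWord.2 (.inr hm'))
      (by simp) (by simp) ?_
    rintro (c | c) hc h1 h2
    · rw [inl_mem_markWord] at hc
      rw [Sum.map_inl, Equiv.swap_apply_of_ne_of_ne] <;> rintro rfl <;> simp_all
    · rw [Sum.map_inr, Equiv.swap_apply_of_ne_of_ne (by simpa using h1) (by simpa using h2)]

end Parts

/-! ### Superpartitions index the coefficients of a symmetric superfunction -/

section Coefficients

/-- An integer encoding of the total order on parts; decorations have ranks below `4`. -/
def Part.key (a : Part) : ℕ := 4 * a.val + a.mark.rank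

lemma Mark.rank_lt (m : Mark) : m.rank < 4 := by cases m <;> simp [Mark.rank]

lemma Mark.rank_injective : Function.Injective Mark.rank := by
  intro a b
  cases a <;> cases b <;> simp [Mark.rank]

lemma Part.key_injective : Function.Injective Part.key := by
  rintro ⟨a, m⟩ ⟨b, m'⟩ h
  have h1 := m.rank_lt
  have h2 := m'.rank_lt
  simp only [Part.key] at h
  obtain rfl : a = b := by omega
  obtain rfl : m = m' := Mark.rank_injective (by omega)
  rfl

lemma Part.gt_iff_key_lt {a b : Part} : a.Gt b ↔ b.key < a.key := by
  have h1 := a.mark.rank_lt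
  have h2 := b.mark.rank_lt
  simp only [Part.Gt, Part.key]
  omega

lemma SPar.ext {Λ M : SPar} (h : Λ.parts = M.parts) : Λ = M := by
  cases Λ; cases M; cases h; rfl

lemma SPar.key_pairwise (Λ : SPar) : Λ.parts.Pairwise fun a b => b.key ≤ a.key :=
  Λ.decreasing.imp fun {a b} h => by
    rcases h with h | ⟨rfl, -⟩
    · exact (Part.gt_iff_key_lt.1 h).le
    · exact le_rfl

/-- A superpartition is determined by its multiset of parts. -/
lemma SPar.eq_of_perm {Λ M : SPar} (h : Λ.parts.Perm M.parts) : Λ = M :=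
  SPar.ext (h.eq_of_pairwise (fun _ _ _ _ h1 h2 => Part.key_injective (le_antisymm h2 h1))
    Λ.key_pairwise M.key_pairwise)

/-- The coefficients of the monomials of a list of parts, in the smallest sufficient number of
variables. -/
def listCoeff (l : List Part) : (∀ N : ℕ, SuperPoly N) →ₗ[ℚ] ℚ :=
  partCoeff l.get ∘ₗ LinearMap.proj l.length

lemma listCoeff_ofFn {N : ℕ} (P : Fin N → Part) (f : ∀ N : ℕ, SuperPoly N) :
    listCoeff (List.ofFn P) f = partCoeff P (f N) := by
  have key : ∀ (l : List Part) (M : ℕ) (h : l.length = M),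
      listCoeff l f = partCoeff (fun i : Fin M => l.get (i.cast h.symm)) (f M) := by
    rintro l _ rfl
    rfl
  rw [key _ N (List.length_ofFn)]
  congr 2
  ext1 i
  simp

/-- The coefficients of a superfunction at superpartitions. -/
def superCoeff : (∀ N : ℕ, SuperPoly N) →ₗ[ℚ] (SPar → ℚ) :=
  LinearMap.pi fun Λ => listCoeff Λ.parts

lemma superCoeff_apply (f : ∀ N : ℕ, SuperPoly N) (Λ : SPar) :
    superCoeff f Λ = listCoeff Λ.parts f := rfl

/-- Symmetric superfunctions without any condition on their degrees. -/
def IsStableSymmetric (f : ∀ N : ℕ, SuperPoly N) : Prop :=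
  ∀ N : ℕ, (∀ σ : Equiv.Perm (Fin N), permute σ (f N) = f N) ∧ restrict N (f (N + 1)) = f N

lemma isStableSymmetric_of_mem {f : ∀ N : ℕ, SuperPoly N} (hf : f ∈ symFun) :
    IsStableSymmetric f := by
  let S : Submodule ℚ (∀ N : ℕ, SuperPoly N) :=
    { carrier := {f | IsStableSymmetric f}
      zero_mem' := fun N => ⟨fun σ => map_zero _, map_zero _⟩
      add_mem' := fun {f g} hf hg N =>
        ⟨fun σ => by rw [Pi.add_apply, map_add, (hf N).1, (hg N).1],
          by rw [Pi.add_apply, Pi.add_apply, map_add, (hf N).2, (hg N).2]⟩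
      smul_mem' := fun c f hf N =>
        ⟨fun σ => by rw [Pi.smul_apply, map_smul, (hf N).1],
          by rw [Pi.smul_apply, Pi.smul_apply, map_smul, (hf N).2]⟩ }
  have : symFun ≤ S := iSup_le fun n => iSup_le fun k => iSup_le fun l => fun f hf N => (hf N).2
  exact this hf

/-- A symmetric superfunction whose coefficients at superpartitions vanish has no coefficient at
a decreasing family of parts: trailing trivial parts are removed by stability, and families with
a forbidden repetition contribute nothing by antisymmetry. -/
lemma partCoeff_eq_zero_of_antitone {f : ∀ N : ℕ, SuperPoly N} (hf : IsStableSymmetric f)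
    (h : superCoeff f = 0) {N : ℕ} (P : Fin N → Part) (hP : Antitone fun i => (P i).key) :
    partCoeff P (f N) = 0 := by
  by_cases hd : ∃ i j, i ≠ j ∧ P i = P j ∧ ¬ (P i).Repeatable
  · obtain ⟨i, j, hij, hPij, hn⟩ := hd
    exact partCoeff_eq_zero_of_eq (hf N).1 hij hPij hn
  push Not at hd
  by_cases ht : ∀ i, (P i).mark = .unmarked → (P i).val ≠ 0
  · let Λ : SPar :=
      { parts := List.ofFn P
        decreasing := by
          rw [List.pairwise_ofFn]
          intro i j hij
          rcases (hP hij.le).lt_or_eq with h' | h'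
          · exact Or.inl (Part.gt_iff_key_lt.2 h')
          · have := Part.key_injective h'.symm
            exact Or.inr ⟨this, hd i j hij.ne this⟩
        no_unmarked_zero := by
          intro a ha
          obtain ⟨i, rfl⟩ := (List.mem_ofFn' _ _).1 ha
          exact ht i }
    rw [← listCoeff_ofFn]
    exact congrFun h Λ
  · push Not at ht
    obtain ⟨i, hi, hi'⟩ := ht
    cases N with
    | zero => exact i.elim0
    | succ N =>
      have hk : (P (Fin.last N)).key ≤ 0 := by
        have := hP (Fin.le_last i)
        simpa [Part.key, hi, hi', Mark.rank] using this
      have hl : P (Fin.last N) = ⟨0, .unmarked⟩ :=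
        Part.key_injective (by simpa [Part.key, Mark.rank] using hk)
      obtain ⟨ε, h0, he⟩ := exists_partCoeff_restrict (f (N + 1)) P (by rw [hl]) (by rw [hl])
      rw [(hf N).2, partCoeff_eq_zero_of_antitone hf h (P ∘ Fin.castSucc)
        (fun i j hij => hP (Fin.castSucc_le_castSucc_iff.2 hij))] at he
      exact (mul_eq_zero.1 he.symm).resolve_left h0

/-- A symmetric superfunction is determined by its coefficients at superpartitions. -/
lemma eq_zero_of_superCoeff {f : ∀ N : ℕ, SuperPoly N} (hf : f ∈ symFun)
    (h : superCoeff f = 0) : f = 0 := by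
  have hs := isStableSymmetric_of_mem hf
  ext1 N
  refine eq_zero_of_monoCoeff fun u w hw => ?_
  obtain ⟨P, rfl, hp⟩ := exists_parts u hw
  obtain ⟨ε, -, he⟩ := exists_monoCoeff_perm (exponent P) hp
  let σ := Tuple.sort fun i => OrderDual.toDual (P i).key
  have hσ : Antitone fun i => ((P ∘ σ) i).key := fun i j hij =>
    Tuple.monotone_sort (fun i => OrderDual.toDual (P i).key) hij
  obtain ⟨δ, h0, hδ⟩ := exists_partCoeff_comp_perm (hs N).1 P σ
  rw [partCoeff_eq_zero_of_antitone hs h _ hσ] at hδ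
  rw [he, LinearMap.smul_apply, ← partCoeff, (mul_eq_zero.1 hδ.symm).resolve_left h0, smul_zero]

/-! ### Weights -/

/-- The total degree of the factor attached to a part; it is also the index `m` of the symmetric
polynomial `f_m` from which that factor is built. -/
def Part.weight (a : Part) : ℕ := a.val + (a.mark.word ()).length

/-- The total degree of a superpartition. -/
def SPar.weight (Λ : SPar) : ℕ := (Λ.parts.map Part.weight).sum

lemma Mark.length_word {α : Type*} (m : Mark) (i : α) :
    (m.word i).length = (m.word ()).length := by
  cases m <;> rfl

/-- Unmarked zeros are the only parts of weight zero, and a superpartition has none. -/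
lemma SPar.weight_pos (Λ : SPar) {a : Part} (ha : a ∈ Λ.parts) : 0 < a.weight := by
  have := Λ.no_unmarked_zero a ha
  cases hm : a.mark <;> (simp_all [Part.weight, Mark.word]; try omega)

lemma finite_part_weight_le (w : ℕ) : {a : Part | a.weight ≤ w}.Finite := by
  refine Set.Finite.of_finite_image (f := Part.key) ((Set.finite_Iio (4 * w + 4)).subset ?_)
    Part.key_injective.injOn
  rintro _ ⟨a, ha, rfl⟩
  have := a.mark.rank_lt
  simp only [Set.mem_ofPred_eq, Part.weight] at ha
  simp only [Part.key, Set.mem_Iio]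
  omega

lemma finite_weight_eq (w : ℕ) : {Λ : SPar | Λ.weight = w}.Finite := by
  have : Finite {a : Part | a.weight ≤ w} := finite_part_weight_le w
  refine Set.Finite.of_finite_image (f := SPar.parts)
    (((List.finite_length_le {a : Part | a.weight ≤ w} w).image
      (List.map Subtype.val)).subset ?_) (fun _ _ _ _ h => SPar.ext h)
  rintro _ ⟨Λ, hΛ, rfl⟩
  simp only [Set.mem_ofPred_eq] at hΛ
  have hw : ∀ a ∈ Λ.parts, a ∈ {a : Part | a.weight ≤ w} := fun a ha =>
    hΛ ▸ List.single_le_sum (fun _ _ => Nat.zero_le _) _ (List.mem_map_of_mem ha)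
  refine ⟨Λ.parts.pmap Subtype.mk hw, ?_, by simp [List.map_pmap]⟩
  have := List.length_le_sum_of_one_le (Λ.parts.map Part.weight) (by
    intro i hi
    obtain ⟨a, ha, rfl⟩ := List.mem_map.1 hi
    exact Λ.weight_pos ha)
  rw [List.length_map, ← SPar.weight, hΛ] at this
  rwa [Set.mem_ofPred_eq, List.length_pmap]

lemma degree_add_length {N : ℕ} (P : Fin N → Part) :
    (exponent P).degree + (markWord P).length = ∑ i, (P i).weight := by
  simp only [Part.weight, Finset.sum_add_distrib, markWord, List.length_flatMap,
    Mark.length_word _ (_ : Fin N), Finsupp.degree_eq_sum, exponent_apply]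
  rw [← List.ofFn_eq_map, List.sum_ofFn]

lemma SPar.weight_eq_sum (Λ : SPar) : ∑ i, (Λ.parts.get i).weight = Λ.weight := by
  rw [SPar.weight, ← List.sum_ofFn, ← Function.comp_def Part.weight, ← List.map_ofFn,
    List.ofFn_get]

/-- A monomial contributes only to the coefficients of superpartitions of its total degree. -/
lemma weight_eq_of_ne_zero {Λ : SPar} {u : Fin Λ.parts.length →₀ ℕ}
    {w : List (Fin Λ.parts.length ⊕ Fin Λ.parts.length)}
    (h : partCoeff Λ.parts.get (mono u w) ≠ 0) : Λ.weight = u.degree + w.length := by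
  obtain ⟨rfl, hw⟩ := eq_and_perm_of_monoCoeff_ne_zero h
  rw [hw.length_eq, degree_add_length, SPar.weight_eq_sum]

lemma mono_zero_eq_prod {N : ℕ} (w : List (Fin N ⊕ Fin N)) :
    mono 0 w = (w.map fun j => (1 : MvPolynomial (Fin N) ℚ) ⊗ₜ[ℚ]
      ExteriorAlgebra.ι ℚ (Pi.single j (1 : ℚ))).prod := by
  induction w with
  | nil => simp
  | cons j w ih =>
    rw [List.map_cons, List.prod_cons, ← ih, mono, wordProd_cons, mono,
      Algebra.TensorProduct.tmul_mul_tmul]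
    simp

lemma monomial_mul_phi_mul_theta {N k l : ℕ} (a : Fin N →₀ ℕ) (I : Fin k → Fin N)
    (J : Fin l → Fin N) :
    ofPoly N (MvPolynomial.monomial a 1) * (List.ofFn fun r => phi (I r)).prod *
        (List.ofFn fun r => theta (J r)).prod =
      mono a ((List.ofFn fun r => Sum.inl (I r)) ++ List.ofFn fun r => Sum.inr (J r)) := by
  rw [show (mono a ((List.ofFn fun r => Sum.inl (I r)) ++ List.ofFn fun r => Sum.inr (J r)))
      = mono a [] * mono 0 (List.ofFn fun r => Sum.inl (I r)) *
        mono 0 (List.ofFn fun r => Sum.inr (J r)) by simp [mono_mul], mono_zero_eq_prod,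
    mono_zero_eq_prod, List.map_ofFn, List.map_ofFn]
  rfl

lemma superCoeff_eq_zero_of_weight {n k l : ℕ} {f : ∀ N : ℕ, SuperPoly N}
    (hf : f ∈ symSector n k l) {Λ : SPar} (hΛ : Λ.weight ≠ n + k + l) : superCoeff f Λ = 0 := by
  have := (hf Λ.parts.length).1
  rw [superCoeff_apply, listCoeff, LinearMap.comp_apply, LinearMap.proj_apply]
  generalize f Λ.parts.length = g at this
  induction this using Submodule.span_induction with
  | zero => simp
  | add x y _ _ hx hy => rw [map_add, hx, hy, add_zero]
  | smul c x _ hx => rw [map_smul, hx, smul_zero]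
  | mem x hx =>
    obtain ⟨a, I, J, ha, rfl⟩ := hx
    rw [monomial_mul_phi_mul_theta]
    by_contra hn
    exact hΛ (by rw [weight_eq_of_ne_zero hn, ha]; simp [add_assoc])

lemma superCoeff_finite {f : ∀ N : ℕ, SuperPoly N} (hf : f ∈ symFun) :
    (Function.support (superCoeff f)).Finite := by
  let S : Submodule ℚ (∀ N : ℕ, SuperPoly N) :=
    { carrier := {f | (Function.support (superCoeff f)).Finite}
      zero_mem' := by simp
      add_mem' := fun {f g} hf hg => by
        rw [Set.mem_ofPred_eq, map_add]
        exact (hf.union hg).subset (Function.support_add _ _)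
      smul_mem' := fun c f hf => by
        rw [Set.mem_ofPred_eq, map_smul]
        exact hf.subset (Function.support_const_smul_subset c _) }
  have : symFun ≤ S := iSup_le fun n => iSup_le fun k => iSup_le fun l => fun f hf =>
    (finite_weight_eq (n + k + l)).subset fun Λ hΛ => by
      by_contra hn
      exact hΛ (superCoeff_eq_zero_of_weight hf hn)
  exact this hf

end Coefficients

/-! ### Products of power sums and their triangularity -/

section PowerSums

/-- The symmetric superpolynomial `∑ x_i ^ n`, each term decorated by `φ_i` and `θ_i` as
prescribed by the part. -/
def partSum (a : Part) (N : ℕ) : SuperPoly N :=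
  ∑ i, mono (Finsupp.single i a.val) (a.mark.word i)

/-- The product of the decorated power sums of the parts of a superpartition. -/
def powerFun (Λ : SPar) : ∀ N : ℕ, SuperPoly N := (Λ.parts.map partSum).prod

variable {N L : ℕ}

/-- The term of a product of decorated power sums in which the `r`-th factor contributes its
summand with index `g r`. -/
def powerTerm (Q : Fin L → Part) (g : Fin L → Fin N) : SuperPoly N :=
  mono (∑ r, Finsupp.single (g r) (Q r).val)
    ((List.finRange L).flatMap fun r => (Q r).mark.word (g r))

lemma prod_map_mono {α : Type*} (l : List α) (u : α → Fin N →₀ ℕ)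
    (w : α → List (Fin N ⊕ Fin N)) :
    (l.map fun r => mono (u r) (w r)).prod = mono (l.map u).sum (l.flatMap w) := by
  induction l with
  | nil => simp
  | cons a l ih => simp [ih, mono_mul]

lemma powerTerm_eq_prod (Q : Fin L → Part) (g : Fin L → Fin N) :
    powerTerm Q g = ((List.finRange L).map fun r =>
      mono (Finsupp.single (g r) (Q r).val) ((Q r).mark.word (g r))).prod := by
  rw [prod_map_mono, powerTerm, ← List.sum_ofFn, List.ofFn_eq_map]

lemma powerFun_apply (M : SPar) (N : ℕ) :
    powerFun M N = ∑ g : Fin M.parts.length → Fin N, powerTerm M.parts.get g := by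
  have h : powerFun M N = (List.ofFn fun r => partSum (M.parts.get r) N).prod := by
    rw [powerFun, Pi.list_prod_apply, List.map_map]
    conv_lhs => rw [← List.ofFn_get M.parts, List.map_ofFn]
    rfl
  have h' := (MultilinearMap.mkPiAlgebraFin ℚ M.parts.length (SuperPoly N)).map_sum
    (fun r i => mono (Finsupp.single i (M.parts.get r).val) ((M.parts.get r).mark.word i))
  simp only [MultilinearMap.mkPiAlgebraFin_apply] at h'
  rw [h]
  simp only [partSum]
  rw [h']
  exact Finset.sum_congr rfl fun g _ => by rw [powerTerm_eq_prod, List.ofFn_eq_map]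

/-- If a term of a product of power sums contributes to the coefficient of a family of nontrivial
parts, then it involves all indices, and if it does so injectively then it matches the parts. -/
lemma surjective_of_partCoeff_ne_zero {P : Fin N → Part} {Q : Fin L → Part} {g : Fin L → Fin N}
    (hP : ∀ i, (P i).mark = .unmarked → (P i).val ≠ 0) (h : partCoeff P (powerTerm Q g) ≠ 0) :
    Function.Surjective g ∧ (Function.Injective g → P ∘ g = Q) := by
  obtain ⟨hu, hw⟩ := eq_and_perm_of_monoCoeff_ne_zero h
  have hl : ∀ i, (∃ r, i = g r ∧ ((Q r).mark = .bilined ∨ (Q r).mark = .overlined)) ↔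
      ((P i).mark = .bilined ∨ (P i).mark = .overlined) := fun i => by
    rw [← inl_mem_markWord, ← hw.mem_iff]
    simp [Mark.inl_mem_word]
  have hr : ∀ i, (∃ r, i = g r ∧ ((Q r).mark = .bilined ∨ (Q r).mark = .underlined)) ↔
      ((P i).mark = .bilined ∨ (P i).mark = .underlined) := fun i => by
    rw [← inr_mem_markWord, ← hw.mem_iff]
    simp [Mark.inr_mem_word]
  have hv : ∀ i, ∑ r, (Finsupp.single (g r) (Q r).val) i = (P i).val := fun i => by
    rw [← exponent_apply P, ← hu, Finsupp.finsetSum_apply]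
  constructor
  · intro i
    by_contra hi
    push Not at hi
    refine hP i ?_ ?_
    · have h1 := mt (hl i).2 (by rintro ⟨r, hr, -⟩; exact hi r hr.symm)
      have h2 := mt (hr i).2 (by rintro ⟨r, hr, -⟩; exact hi r hr.symm)
      cases hm : (P i).mark <;> simp_all
    · rw [← hv]
      exact Finset.sum_eq_zero fun r _ => Finsupp.single_eq_of_ne (hi r).symm
  · intro hg
    ext1 r
    have h1 := hl (g r)
    have h2 := hr (g r)
    have h3 := hv (g r)
    rw [Finset.sum_eq_single r (fun s _ hs => Finsupp.single_eq_of_ne (hg.ne hs).symm) (by simp),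
      Finsupp.single_eq_same] at h3
    simp only [hg.eq_iff, exists_eq_left'] at h1 h2
    rw [Function.comp_apply]
    generalize Q r = q at h1 h2 h3 ⊢
    generalize P (g r) = p at h1 h2 h3 ⊢
    obtain ⟨v, m⟩ := q
    obtain ⟨v', m'⟩ := p
    obtain rfl : v = v' := h3
    clear hP h hu hw hl hr hv
    cases m <;> cases m' <;> simp_all

lemma wordProd_cons_cons_comm {ι : Type*} [DecidableEq ι] (a b : ι) (w : List ι) :
    wordProd (a :: b :: w) = wordProd (w ++ [a, b]) := by
  induction w with
  | nil => rfl
  | cons c w ih =>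
    rw [List.cons_append, wordProd_cons c, ← ih, ← wordProd_cons, wordProd_cons a,
      wordProd_swap b c, mul_neg, ← wordProd_cons, wordProd_swap a c, neg_neg]

lemma mem_center_of_commute_mono {x : SuperPoly N} (h : ∀ u w, mono u w * x = x * mono u w) :
    x ∈ Subalgebra.center ℚ (SuperPoly N) := by
  rw [Subalgebra.mem_center_iff]
  intro y
  have hy : y ∈ Submodule.span ℚ (Set.range fun x : (Fin N →₀ ℕ) × List (Fin N ⊕ Fin N) =>
    mono x.1 x.2) := span_range_mono ▸ Submodule.mem_top
  induction hy using Submodule.span_induction with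
  | mem y hy =>
    obtain ⟨⟨u, w⟩, rfl⟩ := hy
    exact h u w
  | zero => simp
  | add y z _ _ hy hz => rw [add_mul, mul_add, hy, hz]
  | smul c y _ hy => rw [smul_mul_assoc, mul_smul_comm, hy]

lemma mono_nil_mem_center (u : Fin N →₀ ℕ) : mono u [] ∈ Subalgebra.center ℚ (SuperPoly N) :=
  mem_center_of_commute_mono fun v w => by simp [mono_mul, add_comm]

lemma mono_pair_mem_center (u : Fin N →₀ ℕ) (a b : Fin N ⊕ Fin N) :
    mono u [a, b] ∈ Subalgebra.center ℚ (SuperPoly N) :=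
  mem_center_of_commute_mono fun v w => by
    rw [mono_mul, mono_mul, add_comm, mono, mono, List.cons_append, List.cons_append,
      List.nil_append, wordProd_cons_cons_comm]

/-- Central factors can be moved to the front of a product. -/
lemma prod_map_filter_mul {α R : Type*} [Ring R] (l : List α) (f : α → R) (p : α → Bool)
    (hp : ∀ a, p a → ∀ y, Commute (f a) y) :
    (l.map f).prod = ((l.filter p).map f).prod * ((l.filter fun a => !p a).map f).prod := by
  induction l with
  | nil => simp
  | cons a l ih =>
    by_cases ha : p a
    · simp [ha, ih, mul_assoc]
    · have hc : Commute (f a) ((l.filter p).map f).prod := by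
        refine Commute.list_prod_right _ _ fun x hx => ?_
        obtain ⟨b, hb, rfl⟩ := List.mem_map.1 hx
        exact (hp b (List.mem_filter.1 hb).2 _).symm
      simp only [List.map_cons, List.prod_cons, ih, List.filter_cons, ha]
      simp only [Bool.false_eq_true, Bool.not_false, if_true, if_false, List.map_cons,
        List.prod_cons, ← mul_assoc, hc.eq]

/-- Permuting equal repeatable parts does not change a term, as their monomials are central. -/
lemma powerTerm_perm (P : Fin N → Part) (σ : Equiv.Perm (Fin N)) (hσ : P ∘ σ = P)
    (hP : ∀ i j, P i = P j → ¬ (P i).Repeatable → i = j) : powerTerm P σ = powerTerm P id := by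
  classical
  have hσ' : ∀ r, P (σ r) = P r := congrFun hσ
  have hc : ∀ r (i : Fin N), (decide (P r).Repeatable) = true → ∀ y : SuperPoly N,
      Commute (mono (Finsupp.single i (P r).val) ((P r).mark.word i)) y := by
    intro r i hr y
    refine ((Subalgebra.mem_center_iff (R := ℚ)).1 ?_ y).symm
    rcases of_decide_eq_true hr with h | h
    · rw [h]
      exact mono_pair_mem_center _ _ _
    · rw [h]
      exact mono_nil_mem_center _
  rw [powerTerm_eq_prod, powerTerm_eq_prod,
    prod_map_filter_mul _ _ (fun r => decide (P r).Repeatable) (fun r hr => hc r _ hr),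
    prod_map_filter_mul _ (fun r => mono (Finsupp.single (id r) (P r).val) _)
      (fun r => decide (P r).Repeatable) (fun r hr => hc r _ hr)]
  congr 1
  · set l := (List.finRange N).filter fun r => decide (P r).Repeatable with hl
    have hlp : (l.map σ).Perm l := by
      have hn : l.Nodup := (List.nodup_finRange N).filter _
      refine (List.perm_ext_iff_of_nodup (hn.map σ.injective) hn).2 fun i => ?_
      obtain ⟨j, rfl⟩ := σ.surjective i
      rw [List.mem_map_of_injective σ.injective]
      simp [hl, hσ']
    have : (l.map fun r => mono (Finsupp.single (σ r) (P r).val) ((P r).mark.word (σ r))) =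
        (l.map σ).map fun r => mono (Finsupp.single (id r) (P r).val) ((P r).mark.word (id r)) := by
      rw [List.map_map]
      exact List.map_congr_left fun r _ => by simp [hσ']
    rw [this]
    refine (hlp.map _).prod_eq' (List.pairwise_map.2 ?_)
    refine List.pairwise_of_forall_mem_list fun r hr s _ => ?_
    obtain ⟨j, hj, rfl⟩ := List.mem_map.1 hr
    exact hc (σ j) _ (by rw [hσ']; exact (List.mem_filter.1 hj).2) _
  · congr 1
    refine List.map_congr_left fun r hr => ?_
    have : ¬ (P r).Repeatable := by simpa using (List.mem_filter.1 hr).2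
    rw [← hP r (σ r) (hσ' r).symm this, id]

lemma SPar.nontrivial (Λ : SPar) (i : Fin Λ.parts.length) :
    (Λ.parts.get i).mark = .unmarked → (Λ.parts.get i).val ≠ 0 :=
  Λ.no_unmarked_zero _ (List.get_mem _ _)

lemma SPar.eq_of_get_eq (Λ : SPar) (i j : Fin Λ.parts.length)
    (h : Λ.parts.get i = Λ.parts.get j) (hn : ¬ (Λ.parts.get i).Repeatable) : i = j := by
  have key : ∀ i j, Λ.parts.get i = Λ.parts.get j → ¬ (Λ.parts.get i).Repeatable → ¬ i < j := by
    intro i j h hn hij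
    rcases List.pairwise_iff_get.1 Λ.decreasing i j hij with h' | h'
    · rw [Part.gt_iff_key_lt, h] at h'
      exact lt_irrefl _ h'
    · exact hn h'.2
  exact le_antisymm (not_lt.1 (key j i h.symm (h ▸ hn))) (not_lt.1 (key i j h hn))

/-- Products of power sums are triangular with respect to the number of parts, and homogeneous. -/
lemma of_superCoeff_powerFun_ne_zero {M Λ : SPar} (h : superCoeff (powerFun M) Λ ≠ 0) :
    Λ.weight = M.weight ∧ (Λ.parts.length < M.parts.length ∨ Λ = M) := by
  rw [superCoeff_apply, listCoeff, LinearMap.comp_apply, LinearMap.proj_apply, powerFun_apply,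
    map_sum] at h
  obtain ⟨g, -, hg⟩ := Finset.exists_ne_zero_of_sum_ne_zero h
  obtain ⟨hs, hi⟩ := surjective_of_partCoeff_ne_zero Λ.nontrivial hg
  refine ⟨?_, ?_⟩
  · rw [weight_eq_of_ne_zero hg, ← SPar.weight_eq_sum M, List.length_flatMap, map_sum]
    simp only [Finsupp.degree_single, Mark.length_word _ (g _), Part.weight,
      Finset.sum_add_distrib]
    rw [← List.ofFn_eq_map, List.sum_ofFn]
  · rcases (Fintype.card_le_of_surjective g hs).lt_or_eq with hc | hc
    · exact Or.inl (by simpa using hc)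
    · have hb := (Fintype.bijective_iff_surjective_and_card g).2 ⟨hs, hc.symm⟩
      refine Or.inr (SPar.eq_of_perm ?_)
      have hcomp := hi hb.1
      have hl : M.parts.length = Λ.parts.length := by simpa using hc.symm
      rw [← List.ofFn_get M.parts, ← hcomp, ← List.map_ofFn]
      conv_lhs => rw [← List.ofFn_get Λ.parts]
      rw [← Function.comp_id Λ.parts.get, ← List.map_ofFn]
      refine List.Perm.map _ ((List.perm_ext_iff_of_nodup ?_ ?_).2 fun i => ?_)
      · exact List.nodup_ofFn.2 Function.injective_id
      · exact List.nodup_ofFn.2 hb.1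
      · rw [List.mem_ofFn', List.mem_ofFn']
        exact ⟨fun _ => hs i, fun _ => ⟨i, rfl⟩⟩

lemma superCoeff_powerFun_self (M : SPar) : superCoeff (powerFun M) M ≠ 0 := by
  rw [superCoeff_apply, listCoeff, LinearMap.comp_apply, LinearMap.proj_apply, powerFun_apply,
    map_sum]
  -- Every term contributes `0` or `1`, and the term of the identity contributes `1`.
  have hid : partCoeff M.parts.get (powerTerm M.parts.get id) = 1 := by
    have hu : ∑ r, Finsupp.single (id r) (M.parts.get r).val = exponent M.parts.get := by
      ext i
      simp [Finsupp.finsetSum_apply, Finsupp.single_apply]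
    rw [powerTerm, hu]
    exact monoCoeff_self _ (nodup_markWord _)
  refine ne_of_gt (Finset.sum_pos' (fun g _ => ?_) ⟨id, Finset.mem_univ _, ?_⟩)
  · by_cases hg : partCoeff M.parts.get (powerTerm M.parts.get g) = 0
    · exact hg.ge
    · obtain ⟨hs, hi⟩ := surjective_of_partCoeff_ne_zero M.nontrivial hg
      have hb := Finite.injective_iff_surjective.2 hs
      have := powerTerm_perm M.parts.get (Equiv.ofBijective g ⟨hb, hs⟩) (hi hb) M.eq_of_get_eq
      rw [show (⇑(Equiv.ofBijective g ⟨hb, hs⟩) : _ → _) = g from rfl] at this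
      rw [this, hid]
      exact zero_le_one
  · rw [hid]
    exact one_pos

end PowerSums

/-! ### Homogeneous superpolynomials -/

section Homogeneous

variable {N : ℕ}

lemma exists_perm_inl_append_inr {α β : Type*} (w : List (α ⊕ β)) : ∃ (a : List α) (b : List β),
    w.Perm (a.map Sum.inl ++ b.map Sum.inr) ∧ a.length = w.countP Sum.isLeft ∧
      b.length = w.countP Sum.isRight := by
  induction w with
  | nil => exact ⟨[], [], by simp⟩
  | cons c w ih =>
    obtain ⟨a, b, h, ha, hb⟩ := ih
    rcases c with c | c
    · exact ⟨c :: a, b, by simpa using h, by simp [List.countP_cons, ha],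
        by simp [hb]⟩
    · exact ⟨a, c :: b, (h.cons _).trans (by simpa using List.perm_middle.symm),
        by simp [ha], by simp [List.countP_cons, hb]⟩

lemma mono_mem_homogeneous (u : Fin N →₀ ℕ) (w : List (Fin N ⊕ Fin N)) :
    mono u w ∈ homogeneous N u.degree (w.countP Sum.isLeft) (w.countP Sum.isRight) := by
  obtain ⟨a, b, h, ha, hb⟩ := exists_perm_inl_append_inr w
  obtain ⟨ε, -, he⟩ := exists_mono_perm u h
  rw [he, ← ha, ← hb]
  refine Submodule.smul_mem _ _ (Submodule.subset_span ⟨u, a.get, b.get, rfl, ?_⟩)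
  rw [monomial_mul_phi_mul_theta]
  congr 2
  · conv_lhs => rw [← List.ofFn_get a, List.map_ofFn]
    rfl
  · conv_lhs => rw [← List.ofFn_get b, List.map_ofFn]
    rfl

lemma homogeneous_eq_span (N n k l : ℕ) : homogeneous N n k l = Submodule.span ℚ
    {f | ∃ u w, u.degree = n ∧ w.countP Sum.isLeft = k ∧ w.countP Sum.isRight = l ∧
      f = mono u w} := by
  refine le_antisymm (Submodule.span_le.2 ?_) (Submodule.span_le.2 ?_)
  · rintro _ ⟨a, I, J, rfl, rfl⟩
    refine Submodule.subset_span ⟨a, _, rfl, ?_, ?_, monomial_mul_phi_mul_theta a I J⟩ <;>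
    · rw [List.countP_append, ← Function.comp_def Sum.inl, ← Function.comp_def Sum.inr,
        ← List.map_ofFn, ← List.map_ofFn, List.countP_map, List.countP_map]
      simp [Function.comp_def]
  · rintro _ ⟨u, w, rfl, rfl, rfl, rfl⟩
    exact mono_mem_homogeneous u w

lemma mul_mem_homogeneous {n k l n' k' l' : ℕ} {x y : SuperPoly N} (hx : x ∈ homogeneous N n k l)
    (hy : y ∈ homogeneous N n' k' l') : x * y ∈ homogeneous N (n + n') (k + k') (l + l') := by
  rw [homogeneous_eq_span] at hx hy
  have := Submodule.mul_mem_mul hx hy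
  rw [Submodule.span_mul_span] at this
  refine Submodule.span_le.2 ?_ this
  rintro _ ⟨_, ⟨u, w, rfl, rfl, rfl, rfl⟩, _, ⟨u', w', rfl, rfl, rfl, rfl⟩, rfl⟩
  dsimp only
  rw [mono_mul, ← List.countP_append, ← List.countP_append, ← map_add]
  exact mono_mem_homogeneous _ _

lemma one_mem_homogeneous : (1 : SuperPoly N) ∈ homogeneous N 0 0 0 := by
  simpa using mono_mem_homogeneous (0 : Fin N →₀ ℕ) []

lemma countP_isLeft_add_isRight {α β : Type*} (w : List (α ⊕ β)) :
    w.countP Sum.isLeft + w.countP Sum.isRight = w.length := by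
  obtain ⟨a, b, h, ha, hb⟩ := exists_perm_inl_append_inr w
  rw [← ha, ← hb, h.length_eq]
  simp

/-- Superpolynomials of degree one in the anticommuting variables anticommute. -/
lemma mul_eq_neg_of_odd {n k l n' k' l' : ℕ} {x y : SuperPoly N} (hx : x ∈ homogeneous N n k l)
    (hy : y ∈ homogeneous N n' k' l') (hkl : k + l = 1) (hkl' : k' + l' = 1) :
    x * y = -(y * x) := by
  rw [homogeneous_eq_span] at hx hy
  induction hx, hy using Submodule.span_induction₂ with
  | mem_mem x y hx hy =>
    obtain ⟨u, w, rfl, rfl, rfl, rfl⟩ := hx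
    obtain ⟨u', w', rfl, rfl, rfl, rfl⟩ := hy
    rw [countP_isLeft_add_isRight, List.length_eq_one_iff] at hkl hkl'
    obtain ⟨a, rfl⟩ := hkl
    obtain ⟨b, rfl⟩ := hkl'
    rw [mono_mul, mono_mul, mono, mono, List.singleton_append, wordProd_swap,
      List.singleton_append, TensorProduct.tmul_neg, add_comm]
  | zero_left => simp
  | zero_right => simp
  | add_left x y z _ _ _ h1 h2 => rw [add_mul, mul_add, h1, h2, neg_add]
  | add_right x y z _ _ _ h1 h2 => rw [add_mul, mul_add, h1, h2, neg_add]
  | smul_left c x y _ _ h => rw [smul_mul_assoc, mul_smul_comm, h, smul_neg]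
  | smul_right c x y _ _ h => rw [smul_mul_assoc, mul_smul_comm, h, smul_neg]

/-- Superpolynomials of degree zero or two in the anticommuting variables are central. -/
lemma mem_center_of_even {n k l : ℕ} {x : SuperPoly N} (hx : x ∈ homogeneous N n k l)
    (hkl : k + l = 0 ∨ k + l = 2) : x ∈ Subalgebra.center ℚ (SuperPoly N) := by
  rw [homogeneous_eq_span] at hx
  suffices h : Submodule.span ℚ {f | ∃ u w, u.degree = n ∧ w.countP Sum.isLeft = k ∧
      w.countP Sum.isRight = l ∧ f = mono u w} ≤
      Subalgebra.toSubmodule (Subalgebra.center ℚ (SuperPoly N)) from h hx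
  refine Submodule.span_le.2 ?_
  rintro _ ⟨u, w, rfl, rfl, rfl, rfl⟩
  rw [countP_isLeft_add_isRight, List.length_eq_zero_iff, List.length_eq_two] at hkl
  rcases hkl with rfl | ⟨a, b, rfl⟩
  · exact mono_nil_mem_center u
  · exact mono_pair_mem_center u a b

end Homogeneous

/-! ### The companions of a symmetric polynomial -/

section Companion

variable {N : ℕ}

/-- `dOver` as a linear map. -/
def dOverLinear (N : ℕ) : SuperPoly N →ₗ[ℚ] SuperPoly N :=
  ∑ i : Fin N, LinearMap.mulLeft ℚ (phi i) ∘ₗ dx i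

/-- `dUnder` as a linear map. -/
def dUnderLinear (N : ℕ) : SuperPoly N →ₗ[ℚ] SuperPoly N :=
  ∑ i : Fin N, LinearMap.mulLeft ℚ (theta i) ∘ₗ dx i

/-- The polynomial `p` with the exterior differentiations prescribed by a decoration applied
to it. -/
def companion (N : ℕ) (m : Mark) : MvPolynomial (Fin N) ℚ →ₗ[ℚ] SuperPoly N :=
  match m with
  | .unmarked => (ofPoly N).toLinearMap
  | .overlined => dOverLinear N ∘ₗ (ofPoly N).toLinearMap
  | .underlined => dUnderLinear N ∘ₗ (ofPoly N).toLinearMap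
  | .bilined => dOverLinear N ∘ₗ dUnderLinear N ∘ₗ (ofPoly N).toLinearMap

lemma dOverLinear_apply (f : SuperPoly N) : dOverLinear N f = dOver f := by
  simp [dOverLinear, dOver]

lemma dUnderLinear_apply (f : SuperPoly N) : dUnderLinear N f = dUnder f := by
  simp [dUnderLinear, dUnder]

/-- The shift in the index of `f` in the definition of `generator` is the number of
differentiations, so that the index is the weight of the part. -/
lemma generator_eq_companion (f : ∀ N : ℕ, ℕ → MvPolynomial (Fin N) ℚ) (a : Part) (N : ℕ) :
    generator f a N = companion N a.mark (f N a.weight) := by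
  obtain ⟨v, m⟩ := a
  cases m <;> simp [generator, companion, dOverLinear_apply, dUnderLinear_apply, Part.weight,
    Mark.word]

lemma dx_ofPoly (i : Fin N) (p : MvPolynomial (Fin N) ℚ) :
    dx i (ofPoly N p) = ofPoly N (MvPolynomial.pderiv i p) := by
  simp [dx, ofPoly]

lemma dx_theta_mul (i j : Fin N) (f : SuperPoly N) : dx i (theta j * f) = theta j * dx i f := by
  induction f using TensorProduct.induction_on with
  | zero => simp
  | add a b ha hb => simp only [mul_add, map_add, ha, hb]
  | tmul p z => simp [dx, theta, Algebra.TensorProduct.tmul_mul_tmul]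

lemma companion_unmarked (p : MvPolynomial (Fin N) ℚ) :
    companion N .unmarked p = ofPoly N p := rfl

lemma companion_overlined (p : MvPolynomial (Fin N) ℚ) :
    companion N .overlined p = ∑ i, phi i * ofPoly N (MvPolynomial.pderiv i p) := by
  simp [companion, dOverLinear, dx_ofPoly]

lemma companion_underlined (p : MvPolynomial (Fin N) ℚ) :
    companion N .underlined p = ∑ i, theta i * ofPoly N (MvPolynomial.pderiv i p) := by
  simp [companion, dUnderLinear, dx_ofPoly]

lemma companion_bilined (p : MvPolynomial (Fin N) ℚ) :
    companion N .bilined p = ∑ i, ∑ j,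
      phi i * (theta j * ofPoly N (MvPolynomial.pderiv i (MvPolynomial.pderiv j p))) := by
  simp [companion, dOverLinear, dUnderLinear, dx_ofPoly, dx_theta_mul]

lemma phi_eq_mono (i : Fin N) : phi i = mono 0 [Sum.inl i] := by
  simp [mono, wordProd, phi]

lemma theta_eq_mono (i : Fin N) : theta i = mono 0 [Sum.inr i] := by
  simp [mono, wordProd, theta]

lemma ofPoly_monomial (u : Fin N →₀ ℕ) (c : ℚ) :
    ofPoly N (MvPolynomial.monomial u c) = c • mono u [] := by
  rw [mono, TensorProduct.smul_tmul', MvPolynomial.smul_monomial, smul_eq_mul, mul_one]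
  rfl

lemma phi_mem_homogeneous (i : Fin N) : phi i ∈ homogeneous N 0 1 0 := by
  simpa [phi_eq_mono] using mono_mem_homogeneous 0 [Sum.inl i]

lemma theta_mem_homogeneous (i : Fin N) : theta i ∈ homogeneous N 0 0 1 := by
  simpa [theta_eq_mono] using mono_mem_homogeneous 0 [Sum.inr i]

lemma ofPoly_mem_homogeneous {n : ℕ} {p : MvPolynomial (Fin N) ℚ} (hp : p.IsHomogeneous n) :
    ofPoly N p ∈ homogeneous N n 0 0 := by
  rw [p.as_sum, map_sum]
  refine Submodule.sum_mem _ fun u hu => ?_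
  rw [ofPoly_monomial]
  refine Submodule.smul_mem _ _ ?_
  have hd : u.degree = n := by
    rw [Finsupp.degree_eq_weight_one]
    exact hp (MvPolynomial.mem_support_iff.1 hu)
  simpa [hd] using mono_mem_homogeneous u []

/-- The degree in the `φ_i` of the companion attached to a decoration. -/
def Mark.over (m : Mark) : ℕ := (m.word ()).countP Sum.isLeft

/-- The degree in the `θ_i` of the companion attached to a decoration. -/
def Mark.under (m : Mark) : ℕ := (m.word ()).countP Sum.isRight

lemma companion_mem_homogeneous {n : ℕ} {m : Mark} {p : MvPolynomial (Fin N) ℚ}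
    (hp : p.IsHomogeneous (n + (m.word ()).length)) :
    companion N m p ∈ homogeneous N n m.over m.under := by
  cases m with
  | unmarked => exact ofPoly_mem_homogeneous hp
  | overlined =>
    rw [companion_overlined]
    refine Submodule.sum_mem _ fun i _ => ?_
    simpa [Mark.over, Mark.under, Mark.word] using mul_mem_homogeneous (phi_mem_homogeneous i)
      (ofPoly_mem_homogeneous (hp.pderiv (i := i)))
  | underlined =>
    rw [companion_underlined]
    refine Submodule.sum_mem _ fun i _ => ?_
    simpa [Mark.over, Mark.under, Mark.word] using mul_mem_homogeneous (theta_mem_homogeneous i)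
      (ofPoly_mem_homogeneous (hp.pderiv (i := i)))
  | bilined =>
    rw [companion_bilined]
    refine Submodule.sum_mem _ fun i _ => Submodule.sum_mem _ fun j _ => ?_
    change _ ∈ homogeneous N n 1 1
    simpa [Mark.word] using mul_mem_homogeneous (phi_mem_homogeneous i)
      (mul_mem_homogeneous (theta_mem_homogeneous j)
        (ofPoly_mem_homogeneous ((hp.pderiv (i := j)).pderiv (i := i))))

/-! ### Leibniz rules -/

lemma commute_ofPoly (p : MvPolynomial (Fin N) ℚ) (f : SuperPoly N) :
    ofPoly N p * f = f * ofPoly N p := by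
  induction f using TensorProduct.induction_on with
  | zero => simp
  | add a b ha hb => rw [mul_add, add_mul, ha, hb]
  | tmul q z => simp [ofPoly, Algebra.TensorProduct.tmul_mul_tmul, mul_comm]

lemma companion_overlined_mul (p q : MvPolynomial (Fin N) ℚ) :
    companion N .overlined (p * q) = companion N .overlined p * companion N .unmarked q +
      companion N .unmarked p * companion N .overlined q := by
  simp only [companion_overlined, companion_unmarked, Finset.sum_mul, Finset.mul_sum,
    ← Finset.sum_add_distrib]
  refine Finset.sum_congr rfl fun i _ => ?_
  rw [Derivation.leibniz, smul_eq_mul, smul_eq_mul, map_add, map_mul, map_mul, mul_add,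
    ← mul_assoc (ofPoly N p), commute_ofPoly p (phi i), commute_ofPoly q, mul_assoc, mul_assoc,
    add_comm]

lemma companion_underlined_mul (p q : MvPolynomial (Fin N) ℚ) :
    companion N .underlined (p * q) = companion N .underlined p * companion N .unmarked q +
      companion N .unmarked p * companion N .underlined q := by
  simp only [companion_underlined, companion_unmarked, Finset.sum_mul, Finset.mul_sum,
    ← Finset.sum_add_distrib]
  refine Finset.sum_congr rfl fun i _ => ?_
  rw [Derivation.leibniz, smul_eq_mul, smul_eq_mul, map_add, map_mul, map_mul, mul_add,
    ← mul_assoc (ofPoly N p), commute_ofPoly p (theta i), commute_ofPoly q, mul_assoc, mul_assoc,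
    add_comm]

lemma theta_mul_phi (i j : Fin N) : theta i * phi j = -(phi j * theta i) :=
  mul_eq_neg_of_odd (theta_mem_homogeneous i) (phi_mem_homogeneous j) rfl rfl

/-- The mixed second derivatives give two cross terms, which have opposite signs because `φ_i` and
`θ_j` anticommute. -/
lemma companion_bilined_mul (p q : MvPolynomial (Fin N) ℚ) :
    companion N .bilined (p * q) = companion N .bilined p * companion N .unmarked q +
      companion N .overlined p * companion N .underlined q -
      companion N .underlined p * companion N .overlined q +
      companion N .unmarked p * companion N .bilined q := by
  have h1 : companion N .overlined p * companion N .underlined q = ∑ i, ∑ j, phi i * (theta j *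
      ofPoly N (MvPolynomial.pderiv i p * MvPolynomial.pderiv j q)) := by
    rw [companion_overlined, companion_underlined, Finset.sum_mul_sum]
    refine Finset.sum_congr rfl fun i _ => Finset.sum_congr rfl fun j _ => ?_
    rw [mul_assoc, ← mul_assoc (ofPoly N _), commute_ofPoly, map_mul, mul_assoc]
  have h2 : companion N .underlined p * companion N .overlined q = -∑ i, ∑ j, phi i * (theta j *
      ofPoly N (MvPolynomial.pderiv j p * MvPolynomial.pderiv i q)) := by
    rw [companion_overlined, companion_underlined, Finset.sum_mul_sum, Finset.sum_comm,
      ← Finset.sum_neg_distrib]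
    refine Finset.sum_congr rfl fun i _ => ?_
    rw [← Finset.sum_neg_distrib]
    refine Finset.sum_congr rfl fun j _ => ?_
    rw [mul_assoc, ← mul_assoc (ofPoly N _), commute_ofPoly, map_mul, mul_assoc, ← mul_assoc,
      theta_mul_phi, ← neg_one_smul ℚ, smul_mul_assoc, neg_one_smul, mul_assoc]
  rw [h1, h2, sub_neg_eq_add]
  simp only [companion_bilined, companion_unmarked, Finset.sum_mul, Finset.mul_sum,
    ← Finset.sum_add_distrib]
  refine Finset.sum_congr rfl fun i _ => Finset.sum_congr rfl fun j _ => ?_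
  rw [commute_ofPoly p, mul_assoc, mul_assoc, mul_assoc, mul_assoc, ← map_mul, ← map_mul,
    ← mul_add, ← mul_add, ← mul_add, ← mul_add, ← mul_add, ← mul_add, ← map_add, ← map_add,
    ← map_add]
  congr 3
  simp only [Derivation.leibniz, smul_eq_mul, map_add]
  ring

/-! ### Compatibility with permutations and restriction -/

lemma permute_ofPoly (σ : Equiv.Perm (Fin N)) (p : MvPolynomial (Fin N) ℚ) :
    permute σ (ofPoly N p) = ofPoly N (MvPolynomial.rename σ p) := by
  simp [permute, ofPoly]

lemma permute_phi (σ : Equiv.Perm (Fin N)) (i : Fin N) : permute σ (phi i) = phi (σ i) := by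
  have := map_funLeft_wordProd (Equiv.sumCongr σ σ) [Sum.inl i]
  simp only [wordProd, List.map_cons, List.map_nil, List.prod_singleton] at this
  rw [permute, phi, Algebra.TensorProduct.map_tmul, map_one, phi]
  exact congrArg _ this

lemma permute_theta (σ : Equiv.Perm (Fin N)) (i : Fin N) :
    permute σ (theta i) = theta (σ i) := by
  have := map_funLeft_wordProd (Equiv.sumCongr σ σ) [Sum.inr i]
  simp only [wordProd, List.map_cons, List.map_nil, List.prod_singleton] at this
  rw [permute, theta, Algebra.TensorProduct.map_tmul, map_one, theta]
  exact congrArg _ this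

lemma permute_companion (σ : Equiv.Perm (Fin N)) (m : Mark) (p : MvPolynomial (Fin N) ℚ) :
    permute σ (companion N m p) = companion N m (MvPolynomial.rename σ p) := by
  cases m with
  | unmarked => exact permute_ofPoly σ p
  | overlined =>
    simp only [companion_overlined, map_sum, map_mul, permute_phi, permute_ofPoly,
      ← MvPolynomial.pderiv_rename σ.injective]
    exact Fintype.sum_equiv σ _ _ fun i => rfl
  | underlined =>
    simp only [companion_underlined, map_sum, map_mul, permute_theta, permute_ofPoly,
      ← MvPolynomial.pderiv_rename σ.injective]
    exact Fintype.sum_equiv σ _ _ fun i => rfl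
  | bilined =>
    simp only [companion_bilined, map_sum, map_mul, permute_theta, permute_phi, permute_ofPoly,
      ← MvPolynomial.pderiv_rename σ.injective]
    exact Fintype.sum_equiv σ _ _ fun i => Fintype.sum_equiv σ _ _ fun j => rfl

/-- Setting the last commuting variable to zero. -/
def restrictPoly (N : ℕ) : MvPolynomial (Fin (N + 1)) ℚ →ₐ[ℚ] MvPolynomial (Fin N) ℚ :=
  MvPolynomial.aeval (Fin.lastCases 0 MvPolynomial.X)

lemma restrict_ofPoly (p : MvPolynomial (Fin (N + 1)) ℚ) :
    restrict N (ofPoly (N + 1) p) = ofPoly N (restrictPoly N p) := by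
  rw [restrict, ofPoly, Algebra.TensorProduct.includeLeft_apply, Algebra.TensorProduct.map_tmul,
    map_one]
  rfl

lemma funLeft_single_inj {ι κ : Type*} [DecidableEq ι] [DecidableEq κ] {f : ι → κ}
    (hf : Function.Injective f) (i : ι) :
    LinearMap.funLeft ℚ ℚ f (Pi.single (f i) 1) = Pi.single i 1 := by
  ext j
  simp [LinearMap.funLeft_apply, Pi.single_apply, hf.eq_iff]

lemma funLeft_single_notMem {ι κ : Type*} [DecidableEq κ] {f : ι → κ} {k : κ}
    (hk : ∀ i, f i ≠ k) : LinearMap.funLeft ℚ ℚ f (Pi.single k 1) = 0 := by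
  ext j
  simp [LinearMap.funLeft_apply, hk]

lemma injective_sumMap_castSucc :
    Function.Injective (Sum.map (Fin.castSucc (n := N)) (Fin.castSucc (n := N))) :=
  Sum.map_injective.2 ⟨Fin.castSucc_injective N, Fin.castSucc_injective N⟩

lemma restrict_phi_castSucc (i : Fin N) : restrict N (phi i.castSucc) = phi i := by
  rw [restrict, phi, Algebra.TensorProduct.map_tmul, map_one, ExteriorAlgebra.map_apply_ι]
  exact congrArg (fun v => (1 : MvPolynomial (Fin N) ℚ) ⊗ₜ[ℚ] ExteriorAlgebra.ι ℚ v)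
    (funLeft_single_inj injective_sumMap_castSucc (Sum.inl i))

lemma restrict_theta_castSucc (i : Fin N) : restrict N (theta i.castSucc) = theta i := by
  rw [restrict, theta, Algebra.TensorProduct.map_tmul, map_one, ExteriorAlgebra.map_apply_ι]
  exact congrArg (fun v => (1 : MvPolynomial (Fin N) ℚ) ⊗ₜ[ℚ] ExteriorAlgebra.ι ℚ v)
    (funLeft_single_inj injective_sumMap_castSucc (Sum.inr i))

lemma restrict_phi_last : restrict N (phi (Fin.last N)) = 0 := by
  rw [restrict, phi, Algebra.TensorProduct.map_tmul, ExteriorAlgebra.map_apply_ι,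
    funLeft_single_notMem, map_zero, TensorProduct.tmul_zero]
  rintro (i | i) <;> simp [Fin.castSucc_ne_last]

lemma restrict_theta_last : restrict N (theta (Fin.last N)) = 0 := by
  rw [restrict, theta, Algebra.TensorProduct.map_tmul, ExteriorAlgebra.map_apply_ι,
    funLeft_single_notMem, map_zero, TensorProduct.tmul_zero]
  rintro (i | i) <;> simp [Fin.castSucc_ne_last]

lemma restrictPoly_pderiv (i : Fin N) (p : MvPolynomial (Fin (N + 1)) ℚ) :
    restrictPoly N (MvPolynomial.pderiv i.castSucc p) =
      MvPolynomial.pderiv i (restrictPoly N p) := by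
  induction p using MvPolynomial.induction_on with
  | C a => simp [restrictPoly]
  | add p q hp hq => simp only [map_add, hp, hq]
  | mul_X p j hp =>
    simp only [Derivation.leibniz, map_mul, map_add, smul_eq_mul, hp]
    congr 2
    induction j using Fin.lastCases with
    | last =>
      rw [MvPolynomial.pderiv_X_of_ne (Fin.castSucc_ne_last i).symm, map_zero]
      simp [restrictPoly]
    | cast j => simp [restrictPoly, MvPolynomial.pderiv_X, Pi.single_apply]

lemma restrict_companion (m : Mark) (p : MvPolynomial (Fin (N + 1)) ℚ) :
    restrict N (companion (N + 1) m p) = companion N m (restrictPoly N p) := by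
  cases m with
  | unmarked => exact restrict_ofPoly p
  | overlined =>
    simp [companion_overlined, restrict_phi_castSucc, restrict_phi_last, restrict_ofPoly,
      restrictPoly_pderiv, Fin.sum_univ_castSucc]
  | underlined =>
    simp [companion_underlined, restrict_theta_castSucc, restrict_theta_last, restrict_ofPoly,
      restrictPoly_pderiv, Fin.sum_univ_castSucc]
  | bilined =>
    simp [companion_bilined, restrict_phi_castSucc, restrict_theta_castSucc, restrict_phi_last,
      restrict_theta_last, restrict_ofPoly, restrictPoly_pderiv, Fin.sum_univ_castSucc]

end Companion

/-! ### Newton's identities -/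

section Newton

open MvPolynomial Finset

lemma prod_map_X_eq_monomial {σ : Type*} [DecidableEq σ] (s : Multiset σ) :
    (s.map (X : σ → MvPolynomial σ ℚ)).prod = monomial (Multiset.toFinsupp s) 1 := by
  induction s using Multiset.induction with
  | empty => simp
  | cons a s ih =>
    rw [Multiset.map_cons, Multiset.prod_cons, ih, X, monomial_mul, one_mul,
      ← Multiset.singleton_add, map_add, Multiset.toFinsupp_singleton]

lemma coeff_hsymm {σ : Type*} [Fintype σ] [DecidableEq σ] (n : ℕ) (u : σ →₀ ℕ) :
    (hsymm σ ℚ n).coeff u = if u.degree = n then 1 else 0 := by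
  simp only [hsymm, coeff_sum, prod_map_X_eq_monomial, coeff_monomial]
  have hu : ∀ s : Sym σ n, Multiset.toFinsupp s.1 = u ↔ s.1 = Finsupp.toMultiset u := fun s => by
    rw [← Multiset.toFinsupp_symm_apply, AddEquiv.eq_symm_apply]
  have hc : (Finsupp.toMultiset u).card = u.degree := by
    rw [Finsupp.card_toMultiset]
    rfl
  split_ifs with h
  · rw [sum_eq_single ⟨Finsupp.toMultiset u, hc.trans h⟩]
    · exact if_pos ((hu ⟨Finsupp.toMultiset u, hc.trans h⟩).2 rfl)
    · exact fun s _ hs => if_neg fun h' => hs (Subtype.ext ((hu s).1 h'))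
    · exact fun h' => absurd (mem_univ _) h'
  · refine sum_eq_zero fun s _ => if_neg fun h' => h ?_
    rw [← hc, ← (hu s).1 h', s.2]

/-- Newton's identity for the complete homogeneous polynomials.  In the coefficient of `x ^ u`, for
`u` of degree `k`, each pair `(i, r)` with `r < u i` contributes `1`. -/
lemma mul_hsymm_eq_sum (N k : ℕ) : (k : ℚ) • hsymm (Fin N) ℚ k =
    ∑ a ∈ antidiagonal k with a.1 < k, hsymm (Fin N) ℚ a.1 * psum (Fin N) ℚ a.2 := by
  have h1 : ∑ a ∈ antidiagonal k with a.1 < k, hsymm (Fin N) ℚ a.1 * psum (Fin N) ℚ a.2 =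
      ∑ r ∈ range k, ∑ i : Fin N,
        monomial (Finsupp.single i (r + 1)) 1 * hsymm (Fin N) ℚ (k - (r + 1)) := by
    refine sum_bij' (fun a _ => a.2 - 1) (fun r _ => (k - (r + 1), r + 1)) ?_ ?_ ?_ ?_ ?_
    · rintro ⟨a, b⟩ h
      simp only [mem_filter, HasAntidiagonal.mem_antidiagonal, mem_range] at h ⊢
      omega
    · intro r h
      simp only [mem_filter, HasAntidiagonal.mem_antidiagonal, mem_range] at h ⊢
      omega
    · rintro ⟨a, b⟩ h
      simp only [mem_filter, HasAntidiagonal.mem_antidiagonal, Prod.mk.injEq] at h ⊢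
      omega
    · intro r h
      simp
    · rintro ⟨a, b⟩ h
      simp only [mem_filter, HasAntidiagonal.mem_antidiagonal] at h
      obtain ⟨r, rfl⟩ : ∃ r, b = r + 1 := ⟨b - 1, by omega⟩
      rw [Nat.add_sub_cancel, show k - (r + 1) = a by omega, psum, ← sum_mul, mul_comm]
      simp only [X_pow_eq_monomial]
  rw [h1]
  ext u
  rw [coeff_smul, coeff_hsymm, coeff_sum, sum_congr rfl fun r _ => coeff_sum _ _ _]
  have h2 : ∀ r ∈ range k, ∀ i ∈ univ,
      (monomial (Finsupp.single i (r + 1)) 1 * hsymm (Fin N) ℚ (k - (r + 1))).coeff u =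
        if u.degree = k ∧ r < u i then 1 else 0 := by
    intro r hr i _
    rw [coeff_monomial_mul', coeff_hsymm, one_mul]
    by_cases h : r + 1 ≤ u i
    · have hd : (u - Finsupp.single i (r + 1)).degree + (r + 1) = u.degree := by
        conv_rhs => rw [← tsub_add_cancel_of_le (Finsupp.single_le_iff.2 h), map_add,
          Finsupp.degree_single]
      rw [if_pos (Finsupp.single_le_iff.2 h)]
      have := mem_range.1 hr
      refine if_congr ?_ rfl rfl
      omega
    · rw [if_neg (mt Finsupp.single_le_iff.1 h), if_neg (fun h' => h h'.2)]
  rw [sum_congr rfl fun r hr => sum_congr rfl (h2 r hr)]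
  by_cases hk : u.degree = k
  · simp only [hk, true_and, if_true]
    rw [sum_comm]
    have h3 : ∀ i ∈ univ, ∑ r ∈ range k, (if r < u i then (1 : ℚ) else 0) = u i := by
      intro i _
      have : u i ≤ k := hk ▸ Finsupp.le_degree i u
      rw [sum_boole]
      congr 1
      rw [show ({r ∈ range k | r < u i}) = range (u i) by ext; simp; omega, card_range]
    rw [sum_congr rfl h3, ← hk, Finsupp.degree_eq_sum]
    simp
  · simp [hk]

/-- A family of symmetric polynomials that is linked to the power sums by a triangular recursion
of Newton's type, with leading coefficients `α k` and lower coefficients `β i`. -/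
structure IsNewtonFamily (f : ∀ N : ℕ, ℕ → MvPolynomial (Fin N) ℚ) (α β : ℕ → ℚ) : Prop where
  zero : ∀ N, f N 0 = 1
  ne_zero : ∀ k, 0 < k → α k ≠ 0
  psum_eq : ∀ N k, 0 < k → psum (Fin N) ℚ k = α k • f N k -
    ∑ a ∈ antidiagonal k with 0 < a.1 ∧ a.1 < k, β a.1 • (f N a.1 * psum (Fin N) ℚ a.2)

lemma isNewtonFamily_hsymm :
    IsNewtonFamily (fun N n => hsymm (Fin N) ℚ n) (fun k => k) (fun _ => 1) where
  zero N := hsymm_zero _ _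
  ne_zero k hk := by positivity
  psum_eq N k hk := by
    rw [mul_hsymm_eq_sum, eq_sub_iff_add_eq,
      ← sum_filter_add_sum_filter_not {a ∈ antidiagonal k | a.1 < k} (fun a => 0 < a.1), add_comm,
      filter_filter, filter_filter]
    have : {a ∈ antidiagonal k | a.1 < k ∧ ¬ 0 < a.1} = {(0, k)} := by
      ext ⟨a, b⟩
      simp only [mem_filter, HasAntidiagonal.mem_antidiagonal, mem_singleton, Prod.mk.injEq]
      omega
    rw [this, sum_singleton, hsymm_zero, one_mul]
    simp only [one_smul, and_comm]

lemma isNewtonFamily_esymm :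
    IsNewtonFamily (fun N n => esymm (Fin N) ℚ n) (fun k => (-1) ^ (k + 1) * k)
      (fun k => (-1) ^ k) where
  zero N := esymm_zero _ _
  ne_zero k hk := by
    have : (k : ℚ) ≠ 0 := by positivity
    simp [this]
  psum_eq N k hk := by
    rw [psum_eq_mul_esymm_sub_sum _ _ _ hk]
    simp only [Set.mem_Ioo, smul_eq_C_mul, map_mul, map_pow, map_neg, map_one, map_natCast,
      mul_assoc]

variable {f : ∀ N : ℕ, ℕ → MvPolynomial (Fin N) ℚ} {α β : ℕ → ℚ}

lemma IsNewtonFamily.eq_smul (h : IsNewtonFamily f α β) (N : ℕ) {k : ℕ} (hk : 0 < k) :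
    f N k = (α k)⁻¹ • (psum (Fin N) ℚ k +
      ∑ a ∈ antidiagonal k with 0 < a.1 ∧ a.1 < k, β a.1 • (f N a.1 * psum (Fin N) ℚ a.2)) := by
  rw [eq_inv_smul_iff₀ (h.ne_zero k hk), h.psum_eq N k hk, sub_add_cancel]

/-- An algebra homomorphism that respects the power sums respects the whole family. -/
lemma IsNewtonFamily.map_eq (h : IsNewtonFamily f α β) {N M : ℕ}
    (φ : MvPolynomial (Fin N) ℚ →ₐ[ℚ] MvPolynomial (Fin M) ℚ)
    (hφ : ∀ k, 0 < k → φ (psum (Fin N) ℚ k) = psum (Fin M) ℚ k) (k : ℕ) : φ (f N k) = f M k := by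
  induction k using Nat.strong_induction_on with
  | _ k ih =>
    rcases k.eq_zero_or_pos with rfl | hk
    · rw [h.zero, h.zero, map_one]
    · rw [h.eq_smul N hk, h.eq_smul M hk, map_smul, map_add, map_sum, hφ k hk]
      congr 2
      refine sum_congr rfl fun a ha => ?_
      simp only [mem_filter, HasAntidiagonal.mem_antidiagonal] at ha
      rw [map_smul, map_mul, ih _ ha.2.2, hφ _ (by omega)]

lemma isHomogeneous_psum (N k : ℕ) : (psum (Fin N) ℚ k).IsHomogeneous k :=
  IsHomogeneous.sum _ _ _ fun i _ => isHomogeneous_X_pow i k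

lemma IsNewtonFamily.isHomogeneous (h : IsNewtonFamily f α β) (N k : ℕ) :
    (f N k).IsHomogeneous k := by
  induction k using Nat.strong_induction_on with
  | _ k ih =>
    rcases k.eq_zero_or_pos with rfl | hk
    · rw [h.zero]
      exact isHomogeneous_one _ _
    · rw [h.eq_smul N hk, smul_eq_C_mul]
      refine IsHomogeneous.C_mul ((isHomogeneous_psum N k).add (IsHomogeneous.sum _ _ _ ?_)) _
      intro a ha
      simp only [mem_filter, HasAntidiagonal.mem_antidiagonal] at ha
      rw [smul_eq_C_mul]
      have := (ih _ ha.2.2).mul (isHomogeneous_psum N a.2)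
      rw [ha.1] at this
      exact this.C_mul _

lemma IsNewtonFamily.rename_eq (h : IsNewtonFamily f α β) {N : ℕ} (σ : Equiv.Perm (Fin N))
    (k : ℕ) : rename σ (f N k) = f N k :=
  h.map_eq (rename σ) (fun k _ => rename_psum _ _ k σ) k

lemma IsNewtonFamily.restrictPoly_eq (h : IsNewtonFamily f α β) (N k : ℕ) :
    restrictPoly N (f (N + 1) k) = f N k :=
  h.map_eq (restrictPoly N) (fun k hk => by
    simp [psum, restrictPoly, Fin.sum_univ_castSucc, hk.ne']) k

/-! ### The multiplicative families are symmetric superfunctions -/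

lemma IsNewtonFamily.generator_mem (h : IsNewtonFamily f α β) (a : Part) (N : ℕ) :
    generator f a N ∈ homogeneous N a.val a.mark.over a.mark.under := by
  rw [generator_eq_companion]
  exact companion_mem_homogeneous (h.isHomogeneous N _)

lemma IsNewtonFamily.permute_generator (h : IsNewtonFamily f α β) (a : Part) {N : ℕ}
    (σ : Equiv.Perm (Fin N)) : permute σ (generator f a N) = generator f a N := by
  rw [generator_eq_companion, permute_companion, h.rename_eq]

lemma IsNewtonFamily.restrict_generator (h : IsNewtonFamily f α β) (a : Part) (N : ℕ) :
    restrict N (generator f a (N + 1)) = generator f a N := by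
  rw [generator_eq_companion, restrict_companion, h.restrictPoly_eq, ← generator_eq_companion]

lemma IsNewtonFamily.multiplicative_mem_symFun (h : IsNewtonFamily f α β) (Λ : SPar) :
    multiplicative f Λ ∈ symFun := by
  have key : ∀ l : List Part, (l.map (generator f)).prod ∈ symSector (l.map Part.val).sum
      (l.map fun a => a.mark.over).sum (l.map fun a => a.mark.under).sum := by
    intro l
    induction l with
    | nil => exact fun N => ⟨one_mem_homogeneous, fun σ => map_one _, map_one _⟩
    | cons a l ih =>
      intro N
      simp only [List.map_cons, List.prod_cons, List.sum_cons, Pi.mul_apply, map_mul]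
      refine ⟨mul_mem_homogeneous (h.generator_mem a N) (ih N).1, fun σ => ?_, ?_⟩
      · rw [h.permute_generator, (ih N).2.1]
      · rw [h.restrict_generator, (ih N).2.2]
  exact Submodule.mem_iSup_of_mem _ (Submodule.mem_iSup_of_mem _
    (Submodule.mem_iSup_of_mem _ (key Λ.parts)))

/-! ### The span of a multiplicative family -/

/-- The span of the members of weight `d` of a multiplicative family. -/
def weightSpan (f : ∀ N : ℕ, ℕ → MvPolynomial (Fin N) ℚ) (d : ℕ) :
    Submodule ℚ (∀ N : ℕ, SuperPoly N) :=
  Submodule.span ℚ {g | ∃ Λ : SPar, Λ.weight = d ∧ multiplicative f Λ = g}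

lemma Mark.over_add_under (m : Mark) : m.over + m.under = (m.word ()).length :=
  countP_isLeft_add_isRight _

/-- Generators commute, except that two of odd degree anticommute. -/
lemma IsNewtonFamily.exists_generator_comm (h : IsNewtonFamily f α β) (a b : Part) :
    ∃ ε : ℚ, ε ≠ 0 ∧ generator f a * generator f b = ε • (generator f b * generator f a) := by
  have hc : ∀ a b : Part, (a.mark.over + a.mark.under = 0 ∨ a.mark.over + a.mark.under = 2) →
      generator f a * generator f b = generator f b * generator f a := fun a b hab => by
    ext1 N
    exact ((Subalgebra.mem_center_iff (R := ℚ)).1 (mem_center_of_even (h.generator_mem a N) hab)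
      (generator f b N)).symm
  have hp : ∀ m : Mark, m.over + m.under = 1 ∨ (m.over + m.under = 0 ∨ m.over + m.under = 2) := by
    intro m
    rw [Mark.over_add_under]
    cases m <;> simp [Mark.word]
  rcases hp a.mark with ha | ha
  · rcases hp b.mark with hb | hb
    · refine ⟨-1, by norm_num, ?_⟩
      ext1 N
      exact (mul_eq_neg_of_odd (h.generator_mem a N) (h.generator_mem b N) ha hb).trans
        (neg_one_smul ℚ _).symm
    · exact ⟨1, one_ne_zero, by rw [hc b a hb, one_smul]⟩
  · exact ⟨1, one_ne_zero, by rw [hc a b ha, one_smul]⟩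

lemma IsNewtonFamily.generator_mul_self (h : IsNewtonFamily f α β) {a : Part}
    (ha : ¬ a.Repeatable) : generator f a * generator f a = 0 := by
  have h1 : a.mark.over + a.mark.under = 1 := by
    rw [Mark.over_add_under]
    cases hm : a.mark <;> simp_all [Mark.word, Part.Repeatable]
  ext1 N
  have := mul_eq_neg_of_odd (h.generator_mem a N) (h.generator_mem a N) h1 h1
  have h2 : (2 : ℚ) • (generator f a N * generator f a N) = 0 := by
    rw [two_smul]
    nth_rewrite 1 [this]
    exact neg_add_cancel _
  exact (smul_eq_zero.1 h2).resolve_left two_ne_zero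

lemma IsNewtonFamily.exists_prod_perm (h : IsNewtonFamily f α β) {l l' : List Part}
    (hl : l.Perm l') : ∃ ε : ℚ, ε ≠ 0 ∧
      (l.map (generator f)).prod = ε • (l'.map (generator f)).prod := by
  induction hl with
  | nil => exact ⟨1, one_ne_zero, by simp⟩
  | cons x _ ih =>
    obtain ⟨ε, h0, h⟩ := ih
    refine ⟨ε, h0, ?_⟩
    simp only [List.map_cons, List.prod_cons]
    rw [h, mul_smul_comm]
  | swap x y l =>
    obtain ⟨ε, h0, h⟩ := h.exists_generator_comm y x
    refine ⟨ε, h0, ?_⟩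
    simp only [List.map_cons, List.prod_cons]
    rw [← mul_assoc, h, smul_mul_assoc, mul_assoc]
  | trans _ _ ih1 ih2 =>
    obtain ⟨ε, h0, h⟩ := ih1
    obtain ⟨δ, h0', h'⟩ := ih2
    exact ⟨ε * δ, mul_ne_zero h0 h0', by rw [h, h', smul_smul]⟩

/-- Any product of generators is a multiple of a member of the family: trivial parts are dropped,
the others are sorted, and a forbidden repetition makes the product vanish. -/
lemma IsNewtonFamily.prod_mem_weightSpan (h : IsNewtonFamily f α β) (l : List Part) :
    (l.map (generator f)).prod ∈ weightSpan f (l.map Part.weight).sum := by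
  classical
  let l₀ := l.filter fun a => a ≠ (⟨0, .unmarked⟩ : Part)
  have h1 : generator f ⟨0, .unmarked⟩ = 1 := by
    ext1 N
    simp [generator, h.zero]
  have hw : (l.map Part.weight).sum = (l₀.map Part.weight).sum := by
    induction l with
    | nil => rfl
    | cons a l ih =>
      by_cases ha : a = ⟨0, .unmarked⟩
      · simp [l₀, ha, ih, Part.weight, Mark.word]
      · simp [l₀, ha, ih]
  have hprod : (l.map (generator f)).prod = (l₀.map (generator f)).prod := by
    clear hw
    induction l with
    | nil => rfl
    | cons a l ih =>
      by_cases ha : a = ⟨0, .unmarked⟩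
      · simp [l₀, ha, h1, ih]
      · simp [l₀, ha, ih]
  let l₁ := l₀.mergeSort fun a b => decide (b.key ≤ a.key)
  have hp : l₁.Perm l₀ := List.mergeSort_perm _ _
  obtain ⟨ε, -, hε⟩ := h.exists_prod_perm hp.symm
  rw [hprod, hw, hε, ← (hp.map Part.weight).sum_eq]
  by_cases hd : ∃ a : Part, ¬ a.Repeatable ∧ [a, a].Sublist l₁
  · obtain ⟨a, ha, hs⟩ := hd
    obtain ⟨r, hr⟩ := hs.exists_perm_append
    obtain ⟨δ, -, hδ⟩ := h.exists_prod_perm hr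
    rw [hδ, List.map_append, List.prod_append]
    simp [h.generator_mul_self ha]
  · push Not at hd
    have hs : l₁.Pairwise fun a b => b.key ≤ a.key := by
      have := List.pairwise_mergeSort (le := fun a b : Part => decide (b.key ≤ a.key))
        (by simp only [decide_eq_true_eq]; omega)
        (by simp only [Bool.or_eq_true, decide_eq_true_eq]; omega) l₀
      simpa using this
    refine Submodule.smul_mem _ _ (Submodule.subset_span ⟨⟨l₁, ?_, ?_⟩, rfl, rfl⟩)
    · rw [List.pairwise_iff_forall_sublist] at hs ⊢
      intro a b hab
      rcases (hs hab).lt_or_eq with h' | h'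
      · exact Or.inl (Part.gt_iff_key_lt.2 h')
      · obtain rfl := Part.key_injective h'
        refine Or.inr ⟨rfl, ?_⟩
        by_contra hn
        exact hd _ hn hab
    · intro a ha hm hv
      have := (List.mem_filter.1 (hp.mem_iff.1 ha)).2
      obtain ⟨v, m⟩ := a
      simp_all

lemma IsNewtonFamily.mul_mem_weightSpan (h : IsNewtonFamily f α β) {d d' : ℕ}
    {x y : ∀ N : ℕ, SuperPoly N} (hx : x ∈ weightSpan f d) (hy : y ∈ weightSpan f d') :
    x * y ∈ weightSpan f (d + d') := by
  have := Submodule.mul_mem_mul hx hy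
  rw [weightSpan, weightSpan, Submodule.span_mul_span] at this
  refine Submodule.span_le.2 ?_ this
  rintro _ ⟨_, ⟨Λ, rfl, rfl⟩, _, ⟨M, rfl, rfl⟩, rfl⟩
  have := h.prod_mem_weightSpan (Λ.parts ++ M.parts)
  rwa [List.map_append, List.map_append, List.prod_append, List.sum_append] at this

/-- The companions of a family of polynomials. -/
def companionFun (m : Mark) (F : ∀ N : ℕ, MvPolynomial (Fin N) ℚ) : ∀ N : ℕ, SuperPoly N :=
  fun N => companion N m (F N)

/-- All companions of the family lie in its span, including those of index too small to be
generators, which are constant. -/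
lemma IsNewtonFamily.companion_mem_weightSpan (h : IsNewtonFamily f α β) (m : Mark) (k : ℕ) :
    companionFun m (fun N => f N k) ∈ weightSpan f k := by
  by_cases hk : (m.word ()).length ≤ k
  · have := h.prod_mem_weightSpan [⟨k - (m.word ()).length, m⟩]
    have hw : Part.weight ⟨k - (m.word ()).length, m⟩ = k := Nat.sub_add_cancel hk
    simp only [List.map_cons, List.map_nil, List.prod_singleton, List.sum_singleton, hw] at this
    convert this using 1
    ext1 N
    rw [generator_eq_companion, hw]
    rfl
  · suffices h' : companionFun m (fun N => f N k) = 0 by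
      rw [h']
      exact Submodule.zero_mem _
    ext1 N
    cases m with
    | unmarked => simp [Mark.word] at hk
    | overlined =>
      obtain rfl : k = 0 := by simpa [Mark.word] using hk
      simp [companionFun, h.zero, companion_overlined]
    | underlined =>
      obtain rfl : k = 0 := by simpa [Mark.word] using hk
      simp [companionFun, h.zero, companion_underlined]
    | bilined =>
      have hk' : k < 2 := by simpa [Mark.word] using hk
      interval_cases k
      · simp [companionFun, h.zero, companion_bilined]
      · have h1 := h.eq_smul N one_pos
        rw [filter_false_of_mem (by intro a _; omega), sum_empty, add_zero, psum_one] at h1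
        simp [companionFun, h1, companion_bilined, pderiv_X, Pi.single_apply, apply_ite]

/-- Solving the recursion for the power sums and applying the Leibniz rules, all companions of
power sums are obtained from products of companions of the family. -/
lemma IsNewtonFamily.companion_psum_mem_weightSpan (h : IsNewtonFamily f α β) {k : ℕ} (hk : 0 < k)
    (m : Mark) : companionFun m (fun N => psum (Fin N) ℚ k) ∈ weightSpan f k := by
  induction k using Nat.strong_induction_on generalizing m with
  | _ k ih =>
    have he : companionFun m (fun N => psum (Fin N) ℚ k) =
        α k • companionFun m (fun N => f N k) -
        ∑ a ∈ antidiagonal k with 0 < a.1 ∧ a.1 < k,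
          β a.1 • companionFun m (fun N => f N a.1 * psum (Fin N) ℚ a.2) := by
      ext1 N
      simp only [companionFun, Pi.sub_apply, Pi.smul_apply, Finset.sum_apply]
      rw [h.psum_eq N k hk, map_sub, map_smul, map_sum]
      simp only [map_smul]
    rw [he]
    refine Submodule.sub_mem _ (Submodule.smul_mem _ _ (h.companion_mem_weightSpan m k))
      (Submodule.sum_mem _ fun a ha => Submodule.smul_mem _ _ ?_)
    simp only [mem_filter, HasAntidiagonal.mem_antidiagonal] at ha
    have hmul : ∀ m m' : Mark, companionFun m (fun N => f N a.1) *
        companionFun m' (fun N => psum (Fin N) ℚ a.2) ∈ weightSpan f k := fun m m' => by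
      rw [← ha.1]
      exact h.mul_mem_weightSpan (h.companion_mem_weightSpan m a.1)
        (ih a.2 (by omega) (by omega) m')
    cases m with
    | unmarked =>
      convert hmul .unmarked .unmarked using 1
      ext1 N
      exact map_mul (ofPoly N) _ _
    | overlined =>
      convert Submodule.add_mem _ (hmul .overlined .unmarked) (hmul .unmarked .overlined) using 1
      ext1 N
      exact companion_overlined_mul _ _
    | underlined =>
      convert Submodule.add_mem _ (hmul .underlined .unmarked) (hmul .unmarked .underlined) using 1
      ext1 N
      exact companion_underlined_mul _ _
    | bilined =>
      convert Submodule.add_mem _ (Submodule.sub_mem _ (Submodule.add_mem _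
        (hmul .bilined .unmarked) (hmul .overlined .underlined)) (hmul .underlined .overlined))
        (hmul .unmarked .bilined) using 1
      ext1 N
      exact companion_bilined_mul _ _

end Newton

/-! ### Power sums in terms of a multiplicative family -/

section PowerSumsInSpan

open MvPolynomial Finset

variable {N : ℕ}

lemma pderiv_psum_succ (i : Fin N) (k : ℕ) :
    pderiv i (psum (Fin N) ℚ (k + 1)) = monomial (Finsupp.single i k) (k + 1 : ℚ) := by
  simp only [psum, X_pow_eq_monomial, map_sum, pderiv_monomial]
  rw [sum_eq_single i]
  · simp
  · intro j _ hj
    simp [Finsupp.single_eq_of_ne hj.symm]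
  · simp

lemma pderiv_pderiv_psum (i j : Fin N) (k : ℕ) :
    pderiv i (pderiv j (psum (Fin N) ℚ (k + 2))) =
      if j = i then monomial (Finsupp.single i k) ((k + 2) * (k + 1) : ℚ) else 0 := by
  rw [pderiv_psum_succ, pderiv_monomial]
  split_ifs with h
  · subst h
    simp only [← Finsupp.single_tsub, Nat.add_sub_cancel, Finsupp.single_eq_same]
    congr 1
    push_cast
    ring
  · simp [Finsupp.single_eq_of_ne (Ne.symm h)]

lemma mono_mul_smul_mono (u u' : Fin N →₀ ℕ) (w w' : List (Fin N ⊕ Fin N)) (c : ℚ) :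
    mono u w * c • mono u' w' = c • mono (u + u') (w ++ w') := by
  rw [mul_smul_comm, mono_mul]

/-- The decorated power sums are, up to scalars, the companions of the power sums. -/
lemma exists_companion_psum_eq (a : Part) (ha : 0 < a.weight) : ∃ c : ℚ, c ≠ 0 ∧
    companionFun a.mark (fun N => psum (Fin N) ℚ a.weight) = c • partSum a := by
  obtain ⟨v, m⟩ := a
  cases m with
  | unmarked =>
    refine ⟨1, one_ne_zero, ?_⟩
    ext1 N
    change ofPoly N (psum (Fin N) ℚ v) = (1 : ℚ) • ∑ i, mono (Finsupp.single i v) []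
    simp only [psum, X_pow_eq_monomial, map_sum, ofPoly_monomial, one_smul]
  | overlined =>
    refine ⟨v + 1, by positivity, ?_⟩
    ext1 N
    change companion N .overlined (psum (Fin N) ℚ (v + 1)) =
      (v + 1 : ℚ) • ∑ i, mono (Finsupp.single i v) [Sum.inl i]
    simp only [companion_overlined, pderiv_psum_succ, ofPoly_monomial, phi_eq_mono,
      mono_mul_smul_mono, smul_sum, zero_add, List.append_nil]
  | underlined =>
    refine ⟨v + 1, by positivity, ?_⟩
    ext1 N
    change companion N .underlined (psum (Fin N) ℚ (v + 1)) =
      (v + 1 : ℚ) • ∑ i, mono (Finsupp.single i v) [Sum.inr i]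
    simp only [companion_underlined, pderiv_psum_succ, ofPoly_monomial, theta_eq_mono,
      mono_mul_smul_mono, smul_sum, zero_add, List.append_nil]
  | bilined =>
    refine ⟨(v + 2) * (v + 1), by positivity, ?_⟩
    ext1 N
    change companion N .bilined (psum (Fin N) ℚ (v + 2)) =
      ((v + 2) * (v + 1) : ℚ) • ∑ i, mono (Finsupp.single i v) [Sum.inl i, Sum.inr i]
    rw [companion_bilined, smul_sum]
    refine sum_congr rfl fun i _ => ?_
    rw [sum_eq_single i]
    · simp only [pderiv_pderiv_psum, if_true, ofPoly_monomial, phi_eq_mono, theta_eq_mono,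
        mono_mul_smul_mono, zero_add, List.append_nil, List.singleton_append]
    · intro j _ hj
      rw [pderiv_pderiv_psum, if_neg hj, map_zero, mul_zero, mul_zero]
    · simp

variable {f : ∀ N : ℕ, ℕ → MvPolynomial (Fin N) ℚ} {α β : ℕ → ℚ}

lemma IsNewtonFamily.powerFun_mem_weightSpan (h : IsNewtonFamily f α β) (M : SPar) :
    powerFun M ∈ weightSpan f M.weight := by
  have key : ∀ l : List Part, (∀ a ∈ l, 0 < a.weight) →
      (l.map partSum).prod ∈ weightSpan f (l.map Part.weight).sum := by
    intro l hl
    induction l with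
    | nil => simpa using h.prod_mem_weightSpan []
    | cons a l ih =>
      simp only [List.map_cons, List.prod_cons, List.sum_cons]
      refine h.mul_mem_weightSpan ?_ (ih fun b hb => hl b (by simp [hb]))
      obtain ⟨c, hc, he⟩ := exists_companion_psum_eq a (hl a (by simp))
      rw [← inv_smul_smul₀ hc (partSum a), ← he]
      exact Submodule.smul_mem _ _ (h.companion_psum_mem_weightSpan (hl a (by simp)) _)
  exact key M.parts fun a ha => M.weight_pos ha

end PowerSumsInSpan

/-! ### A criterion for bases -/

section Criterion

open Submodule Function

variable {ι E : Type*} [AddCommGroup E] [Module ℚ E]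

lemma eq_sum_single_of_support_subset [DecidableEq ι] {g : ι → ℚ} {s : Finset ι}
    (hs : support g ⊆ s) : g = ∑ j ∈ s, g j • (Pi.single j 1 : ι → ℚ) := by
  ext i
  rw [Finset.sum_apply]
  by_cases hi : i ∈ s
  · rw [Finset.sum_eq_single i]
    · simp
    · intro j _ hj
      simp [Pi.single_eq_of_ne hj.symm]
    · exact fun h => absurd hi h
  · rw [Finset.sum_eq_zero, notMem_support.1 fun h => hi (hs h)]
    intro j hj
    have hij : i ≠ j := fun h => hi (h ▸ hj)
    simp [Pi.single_eq_of_ne hij]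

/-- Let `Φ` be a system of coordinates on `V`, in which every vector has finite support and which
determines the vector.  If a family `q` is triangular in these coordinates within finite blocks,
and each `q i` is a combination of the `h j` in the block of `i`, then `h` is a basis of `V`:
by triangularity the `h j` of a block span all coordinate vectors of that block, and a spanning
family with as many members as the dimension is independent. -/
lemma exists_basis_of_triangular (V : Submodule ℚ E) (Φ : E →ₗ[ℚ] ι → ℚ)
    (hinj : ∀ f ∈ V, Φ f = 0 → f = 0) (hfin : ∀ f ∈ V, (support (Φ f)).Finite)
    (wt len : ι → ℕ) (hwt : ∀ d, {i | wt i = d}.Finite) (q h : ι → E) (hV : ∀ i, h i ∈ V)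
    (hq : ∀ i, q i ∈ span ℚ {g | ∃ j, wt j = wt i ∧ h j = g})
    (htri : ∀ i j, Φ (q i) j ≠ 0 → wt j = wt i ∧ (len j < len i ∨ j = i))
    (hdiag : ∀ i, Φ (q i) i ≠ 0) :
    ∃ b : Module.Basis ι ℚ V, ∀ i, (b i : E) = h i := by
  classical
  let W : ℕ → Submodule ℚ E := fun d => span ℚ {g | ∃ j, wt j = d ∧ h j = g}
  have hWV : ∀ d, W d ≤ V := fun d => span_le.2 (by rintro _ ⟨j, -, rfl⟩; exact hV j)
  have hsingle : ∀ n i, len i = n → (Pi.single i 1 : ι → ℚ) ∈ (W (wt i)).map Φ := by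
    intro n
    induction n using Nat.strong_induction_on with
    | _ n ih =>
      rintro i rfl
      have hi : i ∈ (hfin _ (hWV _ (hq i))).toFinset := by simpa using hdiag i
      have he := eq_sum_single_of_support_subset (g := Φ (q i))
        (s := (hfin _ (hWV _ (hq i))).toFinset) (by simp)
      rw [← Finset.add_sum_erase _ _ hi] at he
      rw [← inv_smul_smul₀ (hdiag i) (Pi.single i 1 : ι → ℚ), ← sub_eq_of_eq_add he]
      refine smul_mem _ _ (sub_mem (mem_map_of_mem (hq i)) (sum_mem fun j hj => smul_mem _ _ ?_))
      rw [Finset.mem_erase, Set.Finite.mem_toFinset] at hj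
      obtain ⟨hw, hl⟩ := htri i j hj.2
      rw [← hw]
      exact ih _ (hl.resolve_right hj.1) j rfl
  have hspan : V ≤ span ℚ (Set.range h) := by
    intro f hf
    have hm : Φ f ∈ (span ℚ (Set.range h)).map Φ := by
      rw [eq_sum_single_of_support_subset (g := Φ f) (s := (hfin f hf).toFinset) (by simp)]
      refine sum_mem fun j _ => smul_mem _ _ (map_mono (span_mono ?_) (hsingle _ j rfl))
      rintro _ ⟨k, -, rfl⟩
      exact ⟨k, rfl⟩
    obtain ⟨g, hg, hfg⟩ := hm
    have hgV : g ∈ V := span_le.2 (by rintro _ ⟨j, rfl⟩; exact hV j) hg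
    have := hinj (f - g) (sub_mem hf hgV) (by rw [map_sub, hfg, sub_self])
    rwa [sub_eq_zero.1 this]
  have hli : LinearIndependent ℚ (Φ ∘ h) := by
    rw [linearIndependent_iff_finset_linearIndependent]
    intro s
    -- The union of the blocks that meet `s` is a finite set to which the counting applies.
    let S : Set ι := ⋃ i ∈ s, {j | wt j = wt i}
    have hS : S.Finite := s.finite_toSet.biUnion fun i _ => hwt (wt i)
    have : Fintype S := hS.fintype
    have hSli : LinearIndependent ℚ fun i : S => Φ (h i) := by
      rw [linearIndependent_iff_card_le_finrank_span]
      have hsli : LinearIndependent ℚ fun i : S => (Pi.single (i : ι) 1 : ι → ℚ) :=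
        (Pi.linearIndependent_single_one ι ℚ).comp _ Subtype.val_injective
      rw [← finrank_span_eq_card hsli]
      have := FiniteDimensional.span_of_finite ℚ (Set.finite_range fun i : S => Φ (h i))
      refine finrank_mono (span_le.2 ?_)
      rintro _ ⟨⟨i, hi⟩, rfl⟩
      have hm := hsingle _ i rfl
      rw [map_span] at hm
      refine span_mono ?_ hm
      rintro _ ⟨_, ⟨j, hj, rfl⟩, rfl⟩
      refine ⟨⟨j, ?_⟩, rfl⟩
      simp only [S, Set.mem_iUnion, Set.mem_ofPred_eq, exists_prop] at hi ⊢
      obtain ⟨k, hk, hik⟩ := hi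
      exact ⟨k, hk, hj.trans hik⟩
    have hsS : ∀ i : s, (i : ι) ∈ S := fun i =>
      Set.mem_biUnion i.2 rfl
    exact hSli.comp (fun i : s => (⟨i, hsS i⟩ : S)) fun i j hij =>
      Subtype.ext (congrArg (fun x : S => (x : ι)) hij)
  let h' : ι → V := fun i => ⟨h i, hV i⟩
  have hli' : LinearIndependent ℚ h' :=
    LinearIndependent.of_comp (Φ ∘ₗ V.subtype) hli
  have htop : ⊤ ≤ span ℚ (Set.range h') := by
    rintro ⟨f, hf⟩ -
    have : f ∈ (span ℚ (Set.range h')).map V.subtype := by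
      rw [map_span, ← Set.range_comp]
      exact hspan hf
    obtain ⟨g, hg, rfl⟩ := this
    exact hg
  exact ⟨Module.Basis.mk hli' htop, fun i => by rw [Module.Basis.mk_apply]⟩

end Criterion

/-- The multiplicative family of a family of Newton's type is a basis of the symmetric
superfunctions. -/
theorem IsNewtonFamily.exists_basis {f : ∀ N : ℕ, ℕ → MvPolynomial (Fin N) ℚ} {α β : ℕ → ℚ}
    (h : IsNewtonFamily f α β) : ∃ b : Module.Basis SPar ℚ symFun,
      ∀ Λ : SPar, (b Λ : ∀ N : ℕ, SuperPoly N) = multiplicative f Λ :=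
  exists_basis_of_triangular symFun superCoeff (fun _ => eq_zero_of_superCoeff)
    (fun _ => superCoeff_finite) SPar.weight (fun Λ => Λ.parts.length) finite_weight_eq
    powerFun (multiplicative f) h.multiplicative_mem_symFun h.powerFun_mem_weightSpan
    (fun _ _ => of_superCoeff_powerFun_ne_zero) superCoeff_powerFun_self

end SuperSym

end

theorem mainTheorem10 :
    (∃ b : Module.Basis SuperSym.SPar ℚ SuperSym.symFun,
      ∀ Λ : SuperSym.SPar, (b Λ : ∀ N : ℕ, SuperSym.SuperPoly N) = SuperSym.hFun Λ) ∧
    (∃ b : Module.Basis SuperSym.SPar ℚ SuperSym.symFun,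
      ∀ Λ : SuperSym.SPar, (b Λ : ∀ N : ℕ, SuperSym.SuperPoly N) = SuperSym.eFun Λ) :=
  ⟨SuperSym.isNewtonFamily_hsymm.exists_basis, SuperSym.isNewtonFamily_esymm.exists_basis⟩
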